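/- Setting. A dictionary is a family $\Psi=(\psi_1,\dots,\psi_K)$ of vectors (atoms) in $\mathbb R^d$. Put $$d(\Phi,\Psi)=\max_k\min_\ell\|\phi_k\pm\psi_\ell\|_2,\qquad d_s(\Phi,\Psi)=\min_{p}\max_k\|\phi_k\pm\psi_{p(k)}\|_2,$$ where $\pm$ means the smaller of the two values and $p$ ranges over the permutations of $\{1,\dots,K\}$; $d_s$ dominates both $d(\Phi,\Psi)$ and $d(\Psi,\Phi)$. Signal model. Let $1\le S\le K$. For $x\in\mathbb R^K$ let $c_x(1)\ge\dots\ge c_x(K)\ge 0$ be the non-increasing rearrangement of $(|x(k)|)_k$, and $c_x(K+1)=0$. Let $\nu$ be a probability measure on the unit sphere of $\mathbb R^K$ that is invariant under sign changes and permutations of the coordinates and is $S$-sparse with absolute gap $\beta_S>0$ and relative gap $\Delta_S>\beta_S$, i.e. for $\nu$-almost all $x$: $c_x(S)-c_x(S+1)\ge\beta_S$ and $(c_x(S)-c_x(S+1))/c_x(1)\ge\Delta_S$. Let $r$ be a centred random vector in $\mathbb R^d$, independent of $x$, subgaussian with parameter $\rho\ge0$: $\mathbb E\,e^{t\langle v,r\rangle}\le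 e^{t^2\rho^2/2}$ for all unit vectors $v$ and all $t$. Signals generated from $\Phi$ are independent copies of $$y=\frac{\Phi x+r}{\sqrt{1+\|r\|_2^2}},\qquad x\sim\nu .$$ Put $\gamma_{1,S}=\mathbb E(c_x(1)+\dots+c_x(S))$ and $C_r=\mathbb E\big((1+\|r\|_2^2)^{-1/2}\big)$. Algorithm. One iteration of ITKsM maps a dictionary $\Psi$ and $N$ signals $y_1,\dots,y_N$ to the dictionary with atoms $\bar\psi_k/\|\bar\psi_k\|_2$, where $$\bar\psi_k=\frac1N\sum_{n:\,k\in I_n}y_n\,\mathrm{sign}\langle\psi_k,y_n\rangle ,$$ and $I_n$ is a set with $|I_n|=S$ that maximises $\sum_{k\in I}|\langle\psi_k,y_n\rangle|$; ties are broken by any fixed measurable rule. Theorem. Let $\Phi$ be a frame of $K$ unit vectors in $\mathbb R^d$ with frame constants $0<A\le B$, i.e. $A\|v\|_2^2\le\sum_k|\langle\phi_k,v\rangle|^2\le B\|v\|_2^2$ for all $v$, and with coherence $\mu=\max_{j\ne k}|\langle\phi_j,\phi_k\rangle|$. Put $$\varepsilon_{\mu,\rho}=\frac{8K^2\sqrt{B+1}}{C_r\gamma_{1,S}}\exp\Big(\frac{-\beta_S^2}{98\max\{\mu^2,\rho^2\}}\Big),\qquad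 R=\frac{\Delta_S}{\sqrt{98B}\Big(\frac14+\sqrt{\log\big(\frac{1060K^2(B+1)}{\Delta_SC_r\gamma_{1,S}}\big)}\Big)},$$ with $\varepsilon_{\mu,\rho}=0$ if $\mu=\rho=0$. Fix a target error $\tilde\varepsilon>0$ with $4\varepsilon_{\mu,\rho}\le\tilde\varepsilon\le R$ and let $\Psi$ be any dictionary of $K$ unit vectors with $d(\Phi,\Psi)\le R$. Then, after $6\lceil\log(\tilde\varepsilon^{-1})\rceil$ iterations of ITKsM started at $\Psi$, each on a fresh batch of $N$ signals, the output dictionary $\tilde\Psi$ satisfies $$d(\Phi,\tilde\Psi)\le\tilde\varepsilon,\qquad d(\tilde\Psi,\Phi)\le\tilde\varepsilon,\qquad d_s(\Phi,\tilde\Psi)\le\tilde\varepsilon,$$ except with probability at most $$18\,\lceil\log(\tilde\varepsilon^{-1})\rceil\,K\exp\Big(\frac{-C_r^2\gamma_{1,S}^2N\tilde\varepsilon^2}{200\,SK}\Big).$$ -/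

import Mathlib

open MeasureTheory ProbabilityTheory
open scoped NNReal ENNReal

noncomputable section

namespace DictLearn

/-- Euclidean space `ℝ^m`. -/
abbrev Vec (m : ℕ) : Type := EuclideanSpace ℝ (Fin m)

/-- A family of `K` vectors (atoms) in `ℝ^d`. -/
abbrev Dict (d K : ℕ) : Type := Fin K → Vec d

/-- All atoms have unit norm. -/
def IsUnitNorm {d K : ℕ} (Φ : Dict d K) : Prop := ∀ k, ‖Φ k‖ = 1

/-- `A` and `B` are frame constants of `Φ`. -/
structure IsFrame {d K : ℕ} (Φ : Dict d K) (A B : ℝ) : Prop where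
  pos : 0 < A
  le : A ≤ B
  lower : ∀ v : Vec d, A * ‖v‖ ^ 2 ≤ ∑ k, |inner ℝ (Φ k) v| ^ 2
  upper : ∀ v : Vec d, ∑ k, |inner ℝ (Φ k) v| ^ 2 ≤ B * ‖v‖ ^ 2

/-- Coherence: the largest absolute inner product of two different atoms
(`0` for a single atom). -/
def coherence {d K : ℕ} (Φ : Dict d K) : ℝ :=
  ⨆ p : {p : Fin K × Fin K // p.1 ≠ p.2}, |inner ℝ (Φ p.1.1) (Φ p.1.2)|

/-- `min ‖u ± v‖`. -/
def atomDist {d : ℕ} (u v : Vec d) : ℝ := min ‖u - v‖ ‖u + v‖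

/-- The asymmetric distance `d(Φ, Ψ) = max_k min_ℓ ‖φ_k ± ψ_ℓ‖`. -/
def dictDist {d K : ℕ} (Φ Ψ : Dict d K) : ℝ := ⨆ k, ⨅ l, atomDist (Φ k) (Ψ l)

/-- The symmetric distance `d_s(Φ, Ψ) = min_p max_k ‖φ_k ± ψ_{p(k)}‖`, with `p` ranging over the
permutations. -/
def symDist {d K : ℕ} (Φ Ψ : Dict d K) : ℝ :=
  ⨅ p : Equiv.Perm (Fin K), ⨆ k, atomDist (Φ k) (Ψ (p k))

/-- The non-increasing rearrangement `c_x` of the absolute values of the entries of `x`: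
`rearr x j` is `c_x(j)` for `1 ≤ j ≤ K`; beyond the last entry the value is `0`. -/
def rearr {K : ℕ} (x : Vec K) (j : ℕ) : ℝ :=
  if h : j - 1 < K then |x (Tuple.sort (fun i => -|x i|) ⟨j - 1, h⟩)| else 0

/-- A probability measure on the unit sphere of `ℝ^K` that is invariant under sign changes and
permutations of the coordinates. -/
structure IsSignPermInvariant {K : ℕ} (ν : Measure (Vec K)) : Prop where
  isProbabilityMeasure : IsProbabilityMeasure ν
  sphere : ∀ᵐ x ∂ν, ‖x‖ = 1
  sign : ∀ s : Fin K → ℝ, (∀ k, s k = 1 ∨ s k = -1) →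
    ν.map (fun x => (WithLp.toLp 2 (fun k => s k * x k) : Vec K)) = ν
  perm : ∀ p : Equiv.Perm (Fin K),
    ν.map (fun x => (WithLp.toLp 2 (fun k => x (p k)) : Vec K)) = ν

/-- The coefficient distribution `ν` is `S`-sparse with absolute gap `β` and relative gap `Δ`. -/
structure IsSparseLaw {K : ℕ} (ν : Measure (Vec K)) (S : ℕ) (β Δ : ℝ) : Prop
    extends IsSignPermInvariant ν where
  gap_pos : 0 < β
  gap_lt : β < Δ
  absGap : ν {x | rearr x S - rearr x (S + 1) < β} = 0
  relGap : ν {x | (rearr x S - rearr x (S + 1)) / rearr x 1 < Δ} = 0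

/-- The law `η` of the noise is centred and subgaussian with parameter `ρ`: for every unit vector
`v`, the marginal satisfies `E exp (t ⟨v, r⟩) ≤ exp (t² ρ² / 2)` for all `t`. -/
structure IsSubgaussianNoise {d : ℕ} (η : Measure (Vec d)) (ρ : ℝ≥0) : Prop where
  isProbabilityMeasure : IsProbabilityMeasure η
  centred : ∫ r, r ∂η = 0
  subgaussian : ∀ v : Vec d, ‖v‖ = 1 → HasSubgaussianMGF (fun r => inner ℝ v r) (ρ ^ 2) η

/-- The signal `(Φ x + r) / √(1 + ‖r‖²)`. -/
def signal {d K : ℕ} (Φ : Dict d K) (x : Vec K) (r : Vec d) : Vec d :=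
  (√(1 + ‖r‖ ^ 2))⁻¹ • ((∑ k, x k • Φ k) + r)

/-- `γ_{1,S} = E (c(1) + ... + c(S))`. -/
def gammaOne {K : ℕ} (ν : Measure (Vec K)) (S : ℕ) : ℝ :=
  ∫ x, ∑ j ∈ Finset.Icc 1 S, rearr x j ∂ν

/-- `C_r = E (1 / √(1 + ‖r‖²))`. -/
def noiseConst {d : ℕ} (η : Measure (Vec d)) : ℝ := ∫ r, (√(1 + ‖r‖ ^ 2))⁻¹ ∂η

/-- A thresholding rule of level `S`: to a dictionary `Ψ` and a signal `y` it assigns a set `I`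
with `S` elements that maximises `‖Ψ_I^* y‖₁`, ties being broken in some measurable way. -/
structure IsThresholding {d K : ℕ} (S : ℕ) (sel : Dict d K → Vec d → Finset (Fin K)) : Prop where
  card : ∀ Ψ y, (sel Ψ y).card = S
  isMax : ∀ Ψ y (J : Finset (Fin K)), J.card = S →
    ∑ k ∈ J, |inner ℝ (Ψ k) y| ≤ ∑ k ∈ sel Ψ y, |inner ℝ (Ψ k) y|
  measurable : ∀ I, MeasurableSet {q : Dict d K × Vec d | sel q.1 q.2 = I}

/-- The signed signal mean
`ψ̄_k = (1/N) ∑_n y_n · sign ⟨ψ_k, y_n⟩ · χ(I_{Ψ,n}, k)`. -/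
def signalMean {d K N : ℕ} (sel : Dict d K → Vec d → Finset (Fin K)) (y : Fin N → Vec d)
    (Ψ : Dict d K) (k : Fin K) : Vec d :=
  (N : ℝ)⁻¹ • ∑ n, if k ∈ sel Ψ (y n) then Real.sign (inner ℝ (Ψ k) (y n)) • y n else 0

/-- One iteration of ITKsM on the batch `y`. -/
def itksmStep {d K N : ℕ} (sel : Dict d K → Vec d → Finset (Fin K)) (y : Fin N → Vec d)
    (Ψ : Dict d K) : Dict d K :=
  fun k => ‖signalMean sel y Ψ k‖⁻¹ • signalMean sel y Ψ k

/-- The output of `L` iterations of ITKsM started at `Ψ`, iteration `i` using the batch `Y i`. -/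
def itksm {d K N : ℕ} (sel : Dict d K → Vec d → Finset (Fin K)) :
    (L : ℕ) → (Fin L → Fin N → Vec d) → Dict d K → Dict d K
  | 0, _, Ψ => Ψ
  | L + 1, Y, Ψ => itksmStep sel (Y (Fin.last L)) (itksm sel L (fun i => Y i.castSucc) Ψ)

/-- The minimal error `ε_{μ,ρ} = 8 K² √(B+1) / (C_r γ) · exp (-β² / (98 max {μ², ρ²}))`, where the
exponential is read as its limit `0` if `μ = ρ = 0`. -/
def minError (K : ℕ) (B C γ β μ ρ : ℝ) : ℝ :=
  8 * (K : ℝ) ^ 2 * √(B + 1) / (C * γ) *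
    (if max (μ ^ 2) (ρ ^ 2) = 0 then 0 else Real.exp (-β ^ 2 / (98 * max (μ ^ 2) (ρ ^ 2))))

/-- The convergence radius
`Δ / (√(98 B) (1/4 + √(log (1060 K² (B+1) / (Δ C_r γ)))))`. -/
def convRadius (K : ℕ) (B C γ Δ : ℝ) : ℝ :=
  Δ / (√(98 * B) * (1 / 4 + √(Real.log (1060 * (K : ℝ) ^ 2 * (B + 1) / (Δ * C * γ)))))

end DictLearn

end

open DictLearn

/-! After a permutation and sign changes of the atoms of Ψ, suppose that every atom lies within a of
the corresponding atom of Φ. The core is that one iteration brings this distance down to 83a/100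
with high probability, as long as a lies between the target error and R.

The comparison is with an ideal mean. If thresholding always found the S dominant atoms with their
signs, the summand for atom k would be `signedSignal`. Its expectation does not depend on Ψ: by sign
and permutation invariance it equals (C_r γ / K) φ_k, and normalising removes the factor. Two errors
remain: the fluctuation of the ideal mean, and the signals on which support or signs are not
recovered.

The response ⟨ψ_k, Φx + r⟩ equals ⟨ψ_k, φ_k⟩ x_k plus three perturbations: interference through the
coherence, interference through the part of ψ_k orthogonal to φ_k, and noise. If each is at most a
seventh of the gap of x, the dominant atoms and their signs are recovered
(`contribution_eq_signedSignal`). Each perturbation is subgaussian, the second after division by the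
sup norm of x, with variance proxies μ², B a² and ρ². The first and third fail with a probability
that does not shrink with a, which is the source of the minimal error. The second fails with
probability of order exp(-Δ²/(98 B a²)), which is at most a small multiple of a once a ≤ R
(`Admissible.perturbation_le`). So the failure rate is a small multiple of a, and a Chernoff bound
controls the actual count.

The fluctuation is handled by a dimension-free Bernstein inequality for vectors
(`measureReal_norm_sum_ge_le`). The second moment of a summand is at most S/K, whence the exponent
of order N ε²/(SK).

Fresh batches are independent of the current iterate, so the one-step bound can be applied
conditionally and the failure probabilities add up. Since 0.83⁶ < 1/e, six iterations per unit of
log(1/ε) suffice. The asymmetric hypothesis on the initial dictionary gives a matching of atoms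
because 4ε_{μ,ρ} ≤ R forces the coherence to stay away from 1. -/

section Concentration

/-! ### Concentration: a Chernoff bound for counts and a Bernstein inequality for vectors. -/

/-- A Chernoff bound for the number of independent samples falling into a set. -/
theorem measureReal_count_ge_le {Ω : Type*} [MeasurableSpace Ω] {P : Measure Ω}
    [IsProbabilityMeasure P] {Z : Type*} [MeasurableSpace Z] {ι : Type*} [Fintype ι]
    {X : ι → Ω → Z} (hX : iIndepFun X P) (hm : ∀ i, AEMeasurable (X i) P) {G : Set Z}
    (hG : MeasurableSet G) {q t : ℝ} (hq : ∀ i, P.real {ω | X i ω ∈ G} ≤ q) :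
    P.real {ω | t ≤ ∑ i, G.indicator (fun _ => (1 : ℝ)) (X i ω)} ≤
      Real.exp (-t + Fintype.card ι * (43 / 25 * q)) := by
  set g : Z → ℝ := G.indicator (fun _ => (1 : ℝ)) with hg
  have hgm : Measurable g := measurable_const.indicator hG
  have hind : iIndepFun (fun i ω => g (X i ω)) P := hX.comp (fun _ => g) fun _ => hgm
  have hgi : ∀ i, AEMeasurable (fun ω => g (X i ω)) P := fun i => hgm.comp_aemeasurable (hm i)
  have hg0 : ∀ z, 0 ≤ g z ∧ g z ≤ 1 := fun z => by
    by_cases h : z ∈ G <;> simp [hg, h]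
  -- An indicator has only the values 0 and 1, so its exponential is affine in it. The Chernoff
  -- parameter is fixed at 1, and 43/25 is a rational upper bound for e - 1.
  have hgexp : ∀ z, Real.exp (1 * g z) = 1 + (Real.exp 1 - 1) * g z := fun z => by
    by_cases h : z ∈ G <;> simp [hg, h]
  have hsum : (fun ω => ∑ i, g (X i ω)) = ∑ i, fun ω => g (X i ω) := by ext ω; simp
  have hint : Integrable (fun ω => Real.exp (1 * ∑ i, g (X i ω))) P := by
    refine Integrable.of_bound (Real.measurable_exp.comp_aemeasurable
      ((Finset.aemeasurable_fun_sum _ fun j _ => hgi j).const_mul 1)).aestronglyMeasurable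
      (Real.exp (Fintype.card ι)) (Filter.Eventually.of_forall fun ω => ?_)
    rw [Real.norm_of_nonneg (Real.exp_pos _).le, one_mul]
    refine Real.exp_le_exp.2 ((Finset.sum_le_sum fun i _ => (hg0 (X i ω)).2).trans (by simp))
  have h1 := measure_ge_le_exp_mul_mgf (μ := P) (X := fun ω => ∑ i, g (X i ω)) t zero_le_one hint
  have h2 : ∀ i, mgf (fun ω => g (X i ω)) P 1 ≤ Real.exp (43 / 25 * q) := fun i => by
    have hset : NullMeasurableSet {ω | X i ω ∈ G} P := (hm i).nullMeasurableSet_preimage hG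
    have e2 : ∫ ω, g (X i ω) ∂P = P.real {ω | X i ω ∈ G} := by
      have : (fun ω => g (X i ω)) = {ω | X i ω ∈ G}.indicator (fun _ => (1 : ℝ)) := by
        ext ω; simp [hg, Set.indicator]
      rw [this, integral_indicator₀ hset, setIntegral_const]
      simp
    have hi : Integrable (fun ω => g (X i ω)) P :=
      Integrable.of_bound (hgi i).aestronglyMeasurable 1 (Filter.Eventually.of_forall fun ω => by
        rw [Real.norm_of_nonneg (hg0 _).1]; exact (hg0 _).2)
    rw [mgf]
    simp_rw [hgexp]
    rw [integral_add (integrable_const _) (hi.const_mul _), integral_const_mul, e2]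
    simp only [integral_const, probReal_univ, smul_eq_mul, mul_one]
    have h3 : Real.exp 1 - 1 ≤ 43 / 25 := by linarith [Real.exp_one_lt_d9]
    have h4 : (Real.exp 1 - 1) * P.real {ω | X i ω ∈ G} ≤ 43 / 25 * q :=
      mul_le_mul h3 (hq i) measureReal_nonneg (by norm_num)
    linarith [Real.add_one_le_exp (43 / 25 * q)]
  refine h1.trans ?_
  rw [hsum, hind.mgf_sum₀ hgi, neg_one_mul, Real.exp_add]
  refine mul_le_mul_of_nonneg_left ?_ (Real.exp_pos _).le
  refine (Finset.prod_le_prod (fun i _ => mgf_nonneg) fun i _ => h2 i).trans ?_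
  rw [Finset.prod_const, ← Real.exp_nat_mul, Finset.card_univ]

/-- As a power series in x, cosh √x has nonnegative coefficients, hence is convex on x ≥ 0; and c²
is the convex combination of (a+b)² and (a-b)² with weights (1±θ)/2. The convexity is applied term
by term. Here θ plays the cosine of an angle and c the third side of a triangle. -/
theorem Real.cosh_sqrt_convex_comb {a b θ : ℝ} (h1 : -1 ≤ θ) (h2 : θ ≤ 1) {c : ℝ}
    (hc : c ^ 2 = a ^ 2 + b ^ 2 + 2 * (a * b * θ)) :
    Real.cosh c ≤ Real.cosh a * Real.cosh b + θ * (Real.sinh a * Real.sinh b) := by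
  have key : Real.cosh c ≤ (1 + θ) / 2 * Real.cosh (a + b) + (1 - θ) / 2 * Real.cosh (a - b) := by
    refine hasSum_le (fun n => ?_) (Real.hasSum_cosh c)
      (((Real.hasSum_cosh (a + b)).mul_left ((1 + θ) / 2)).add
        ((Real.hasSum_cosh (a - b)).mul_left ((1 - θ) / 2)))
    have hconv : ConvexOn ℝ (Set.Ici 0) fun x : ℝ => x ^ n := convexOn_pow n
    have h := hconv.2 (Set.mem_Ici.2 (sq_nonneg (a + b))) (Set.mem_Ici.2 (sq_nonneg (a - b)))
      (by linarith : 0 ≤ (1 + θ) / 2) (by linarith : 0 ≤ (1 - θ) / 2) (by ring)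
    simp only [smul_eq_mul] at h
    have e : (1 + θ) / 2 * (a + b) ^ 2 + (1 - θ) / 2 * (a - b) ^ 2 = c ^ 2 := by rw [hc]; ring
    rw [e, ← pow_mul, ← pow_mul, ← pow_mul] at h
    rw [← mul_div_assoc, ← mul_div_assoc, ← add_div]
    gcongr
  rw [Real.cosh_add, Real.cosh_sub] at key
  linarith

theorem Real.one_le_exp_sub {b : ℝ} : 1 ≤ Real.exp b - b := by
  have := Real.add_one_le_exp b; linarith

variable {E : Type*} [NormedAddCommGroup E] [InnerProductSpace ℝ E]

/-- The law of cosines and the previous convexity give the term cos(angle) sinh‖u‖ sinh‖v‖.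
Replacing sinh‖v‖ by ‖v‖ makes it linear in v, so that it will vanish in expectation; the surplus
sinh‖v‖ - ‖v‖ is absorbed into the factor of cosh‖u‖. -/
theorem Real.cosh_norm_add_le (u v : E) :
    Real.cosh ‖u + v‖ ≤ Real.cosh ‖u‖ * (Real.exp ‖v‖ - ‖v‖)
      + inner ℝ ((Real.sinh ‖u‖ / ‖u‖) • u) v := by
  rcases eq_or_ne u 0 with rfl | hu
  · simp only [zero_add, norm_zero, Real.cosh_zero, one_mul, smul_zero, inner_zero_left, add_zero]
    have h1 := Real.cosh_add_sinh ‖v‖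
    have h2 : ‖v‖ ≤ Real.sinh ‖v‖ := Real.self_le_sinh_iff.2 (norm_nonneg v)
    linarith
  rcases eq_or_ne v 0 with rfl | hv
  · simp
  have ha : 0 < ‖u‖ := norm_pos_iff.2 hu
  have hb : 0 < ‖v‖ := norm_pos_iff.2 hv
  have hab : |inner ℝ u v| ≤ ‖u‖ * ‖v‖ := abs_real_inner_le_norm u v
  set θ : ℝ := inner ℝ u v / (‖u‖ * ‖v‖) with hθ
  have hin : inner ℝ u v = ‖u‖ * ‖v‖ * θ := by rw [hθ]; field_simp
  have habs : |θ| ≤ 1 := by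
    rw [hθ, abs_div, abs_of_pos (mul_pos ha hb)]
    exact div_le_one_of_le₀ hab (by positivity)
  obtain ⟨h1, h2⟩ := abs_le.1 habs
  have h3 := Real.cosh_sqrt_convex_comb (a := ‖u‖) (b := ‖v‖) h1 h2 (c := ‖u + v‖)
    (by rw [norm_add_sq_real, hin]; ring)
  rw [real_inner_smul_left, hin]
  have e : Real.sinh ‖u‖ / ‖u‖ * (‖u‖ * ‖v‖ * θ) = θ * (Real.sinh ‖u‖ * ‖v‖) := by field_simp
  rw [e]
  have h4 := Real.cosh_add_sinh ‖v‖
  have h5 : ‖v‖ ≤ Real.sinh ‖v‖ := Real.self_le_sinh_iff.2 hb.le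
  have h6 : Real.sinh ‖u‖ ≤ Real.cosh ‖u‖ := (Real.sinh_lt_cosh _).le
  have h7 : 0 ≤ Real.sinh ‖u‖ := Real.sinh_nonneg_iff.2 ha.le
  have h8 : θ * (Real.sinh ‖u‖ * (Real.sinh ‖v‖ - ‖v‖)) ≤
      Real.cosh ‖u‖ * (Real.sinh ‖v‖ - ‖v‖) := by
    have h9 : θ * (Real.sinh ‖u‖ * (Real.sinh ‖v‖ - ‖v‖)) ≤
        1 * (Real.sinh ‖u‖ * (Real.sinh ‖v‖ - ‖v‖)) :=
      mul_le_mul_of_nonneg_right h2 (mul_nonneg h7 (by linarith))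
    have h10 := mul_le_mul_of_nonneg_right h6 (sub_nonneg.2 h5)
    linarith
  rw [← h4]
  nlinarith

theorem Real.sinh_div_self_mul_le (u : E) :
    ‖(Real.sinh ‖u‖ / ‖u‖) • u‖ ≤ Real.cosh ‖u‖ := by
  rcases eq_or_ne u 0 with rfl | hu
  · simp
  have ha : 0 < ‖u‖ := norm_pos_iff.2 hu
  have h7 : 0 ≤ Real.sinh ‖u‖ := Real.sinh_nonneg_iff.2 ha.le
  rw [norm_smul, Real.norm_of_nonneg (by positivity), div_mul_cancel₀ _ ha.ne']
  exact (Real.sinh_lt_cosh _).le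

variable {Ω : Type*} [MeasurableSpace Ω] {P : Measure Ω} [IsProbabilityMeasure P]
  [MeasurableSpace E] [BorelSpace E] [FiniteDimensional ℝ E]

/-- One step of the supermartingale argument: the linear term integrates to zero by independence and
centring, and exp b - b ≤ 1 + b² for 0 ≤ b ≤ 1 leaves only the second moment of the new summand. The
dimension never enters. -/
theorem integral_cosh_norm_add_le {U V : Ω → E} (hUV : IndepFun U V P) (hU : AEMeasurable U P)
    (hV : AEMeasurable V P) {b M s : ℝ} (hUb : ∀ᵐ ω ∂P, ‖U ω‖ ≤ b) (hVb : ∀ᵐ ω ∂P, ‖V ω‖ ≤ M)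
    (hM : M ≤ 1) (hV0 : ∫ ω, V ω ∂P = 0) (hV2 : ∫ ω, ‖V ω‖ ^ 2 ∂P ≤ s) :
    ∫ ω, Real.cosh ‖U ω + V ω‖ ∂P ≤ (∫ ω, Real.cosh ‖U ω‖ ∂P) * (1 + s) := by
  have : CompleteSpace E := FiniteDimensional.complete ℝ E
  have hcm : Measurable Real.cosh := Real.continuous_cosh.measurable
  have hsm : Measurable Real.sinh := Real.continuous_sinh.measurable
  have hem : Measurable Real.exp := Real.measurable_exp
  have hUn := hU.norm
  have hVn := hV.norm
  have hbd : ∀ {a c : ℝ}, 0 ≤ a → a ≤ c → ‖Real.cosh a‖ ≤ Real.cosh c := fun {a c} h0 hac => by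
    rw [Real.norm_of_nonneg (Real.cosh_pos _).le]
    exact Real.cosh_le_cosh.2 (by rw [abs_of_nonneg h0, abs_of_nonneg (h0.trans hac)]; exact hac)
  have i1 : Integrable (fun ω => Real.cosh ‖U ω‖) P :=
    Integrable.of_bound (hcm.comp_aemeasurable hUn).aestronglyMeasurable (Real.cosh b)
      (hUb.mono fun ω h => hbd (norm_nonneg _) h)
  have i2 : Integrable (fun ω => Real.cosh ‖U ω + V ω‖) P :=
    Integrable.of_bound (hcm.comp_aemeasurable (hU.add hV).norm).aestronglyMeasurable
      (Real.cosh (b + M)) ((hUb.and hVb).mono fun ω h => hbd (norm_nonneg _)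
        ((norm_add_le _ _).trans (add_le_add h.1 h.2)))
  have hg : Measurable (fun v : E => Real.exp ‖v‖ - ‖v‖) :=
    (hem.comp measurable_norm).sub measurable_norm
  have hh : Measurable (fun u : E => (Real.sinh ‖u‖ / ‖u‖) • u) :=
    ((hsm.comp measurable_norm).div measurable_norm).smul measurable_id
  have hle : ∀ᵐ ω ∂P, Real.exp ‖V ω‖ - ‖V ω‖ ≤ 1 + ‖V ω‖ ^ 2 := hVb.mono fun ω h => by
    have := abs_le.1 (Real.abs_exp_sub_one_sub_id_le (x := ‖V ω‖)
      (by rw [abs_norm]; exact h.trans hM))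
    linarith [this.2]
  have iV2 : Integrable (fun ω => ‖V ω‖ ^ 2) P :=
    Integrable.of_bound (hVn.pow_const 2).aestronglyMeasurable (M ^ 2)
      (hVb.mono fun ω h => by
        rw [Real.norm_of_nonneg (by positivity)]; gcongr)
  have iV : Integrable V P := Integrable.of_bound hV.aestronglyMeasurable M hVb
  have i3 : Integrable (fun ω => Real.exp ‖V ω‖ - ‖V ω‖) P := by
    refine Integrable.mono' ((integrable_const (1 : ℝ)).add iV2)
      (hg.comp_aemeasurable hV).aestronglyMeasurable (hle.mono fun ω h => ?_)
    rw [Real.norm_of_nonneg (by linarith [Real.one_le_exp_sub (b := ‖V ω‖)])]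
    exact h
  have i4 : Integrable (fun ω => (Real.sinh ‖U ω‖ / ‖U ω‖) • U ω) P :=
    Integrable.of_bound (hh.comp_aemeasurable hU).aestronglyMeasurable (Real.cosh b)
      (hUb.mono fun ω h => (Real.sinh_div_self_mul_le _).trans
        ((le_abs_self _).trans (hbd (norm_nonneg _) h)))
  have ind1 : IndepFun (fun ω => Real.cosh ‖U ω‖) (fun ω => Real.exp ‖V ω‖ - ‖V ω‖) P :=
    hUV.comp (hcm.comp measurable_norm) hg
  have ind2 : IndepFun (fun ω => (Real.sinh ‖U ω‖ / ‖U ω‖) • U ω) V P :=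
    hUV.comp hh measurable_id
  have i5 : Integrable (fun ω => Real.cosh ‖U ω‖ * (Real.exp ‖V ω‖ - ‖V ω‖)) P :=
    ind1.integrable_mul i1 i3
  have i6 : Integrable (fun ω => inner ℝ ((Real.sinh ‖U ω‖ / ‖U ω‖) • U ω) (V ω)) P := by
    refine Integrable.of_bound (i4.aestronglyMeasurable.inner iV.aestronglyMeasurable)
      (Real.cosh b * M) ((hUb.and hVb).mono fun ω h => ?_)
    refine (norm_inner_le_norm _ _).trans ?_
    refine mul_le_mul ((Real.sinh_div_self_mul_le _).trans
        ((le_abs_self _).trans (hbd (norm_nonneg _) h.1))) h.2 (norm_nonneg _) (Real.cosh_pos _).le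
  have e6 : ∫ ω, inner ℝ ((Real.sinh ‖U ω‖ / ‖U ω‖) • U ω) (V ω) ∂P = 0 := by
    have h : ∫ ω, inner ℝ ((Real.sinh ‖U ω‖ / ‖U ω‖) • U ω) (V ω) ∂P =
        inner ℝ (∫ ω, (Real.sinh ‖U ω‖ / ‖U ω‖) • U ω ∂P) (∫ ω, V ω ∂P) :=
      ind2.integral_bilin i4 iV (innerSL ℝ)
    rw [h, hV0, inner_zero_right]
  calc ∫ ω, Real.cosh ‖U ω + V ω‖ ∂P
      ≤ ∫ ω, (Real.cosh ‖U ω‖ * (Real.exp ‖V ω‖ - ‖V ω‖)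
          + inner ℝ ((Real.sinh ‖U ω‖ / ‖U ω‖) • U ω) (V ω)) ∂P :=
        integral_mono i2 (i5.add i6) fun ω => Real.cosh_norm_add_le _ _
    _ = (∫ ω, Real.cosh ‖U ω‖ ∂P) * ∫ ω, (Real.exp ‖V ω‖ - ‖V ω‖) ∂P := by
        rw [integral_add i5 i6, e6, add_zero,
          ind1.integral_fun_mul_eq_mul_integral i1.aestronglyMeasurable i3.aestronglyMeasurable]
    _ ≤ (∫ ω, Real.cosh ‖U ω‖ ∂P) * (1 + s) := by
        refine mul_le_mul_of_nonneg_left ?_ (integral_nonneg fun ω => (Real.cosh_pos _).le)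
        have h := integral_mono_ae i3 ((integrable_const (1 : ℝ)).add iV2) hle
        rw [integral_add' (integrable_const _) iV2, integral_const, probReal_univ, one_smul] at h
        linarith

theorem integral_cosh_norm_sum_le {ι : Type*} {X : ι → Ω → E} (hX : iIndepFun X P)
    (hm : ∀ i, AEMeasurable (X i) P) {M s : ℝ} (hb : ∀ i, ∀ᵐ ω ∂P, ‖X i ω‖ ≤ M)
    (hM : M ≤ 1) (h0 : ∀ i, ∫ ω, X i ω ∂P = 0) (h2 : ∀ i, ∫ ω, ‖X i ω‖ ^ 2 ∂P ≤ s)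
    (hs : 0 ≤ s) (T : Finset ι) :
    ∫ ω, Real.cosh ‖∑ i ∈ T, X i ω‖ ∂P ≤ (1 + s) ^ T.card := by
  classical
  induction T using Finset.induction_on with
  | empty => simp
  | insert i T hi ih =>
    have hind := hX.indepFun_finsetSum_of_notMem₀ hm hi
    have e1 : (∑ j ∈ T, X j) = fun ω => ∑ j ∈ T, X j ω := by ext ω; simp
    rw [e1] at hind
    have hbT : ∀ᵐ ω ∂P, ‖∑ j ∈ T, X j ω‖ ≤ T.card * M := by
      have : ∀ᵐ ω ∂P, ∀ j ∈ T, ‖X j ω‖ ≤ M :=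
        (Finset.eventually_all T).2 fun j _ => hb j
      filter_upwards [this] with ω hω
      exact (norm_sum_le_of_le _ hω).trans (by simp)
    have h := integral_cosh_norm_add_le hind (Finset.aemeasurable_fun_sum T fun j _ => hm j) (hm i)
      hbT (hb i) hM (h0 i) (h2 i)
    rw [Finset.card_insert_of_notMem hi, pow_succ]
    calc ∫ ω, Real.cosh ‖∑ j ∈ insert i T, X j ω‖ ∂P
        = ∫ ω, Real.cosh ‖(∑ j ∈ T, X j ω) + X i ω‖ ∂P := by
          congr 1; ext ω; rw [Finset.sum_insert hi, add_comm]
      _ ≤ _ := h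
      _ ≤ _ := mul_le_mul_of_nonneg_right ih (by linarith)

/-- A dimension-free Bernstein inequality for sums of independent bounded random vectors. -/
theorem measureReal_norm_sum_ge_le {ι : Type*} [Fintype ι] {X : ι → Ω → E} (hX : iIndepFun X P)
    (hm : ∀ i, AEMeasurable (X i) P) {M s l t : ℝ} (hb : ∀ i, ∀ᵐ ω ∂P, ‖X i ω‖ ≤ M)
    (h0 : ∀ i, ∫ ω, X i ω ∂P = 0) (h2 : ∀ i, ∫ ω, ‖X i ω‖ ^ 2 ∂P ≤ s)
    (hs : 0 ≤ s) (hl : 0 ≤ l) (hM : l * M ≤ 1) :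
    P.real {ω | t ≤ ‖∑ i, X i ω‖} ≤ 2 * Real.exp (-(l * t) + Fintype.card ι * (l ^ 2 * s)) := by
  have hX' : iIndepFun (fun i ω => l • X i ω) P :=
    hX.comp (fun _ v => l • v) fun _ => measurable_const_smul l
  have hbT : ∀ᵐ ω ∂P, ∀ i, ‖X i ω‖ ≤ M := ae_all_iff.2 hb
  have hmS : AEMeasurable (fun ω => ∑ i, X i ω) P :=
    Finset.aemeasurable_fun_sum _ fun j _ => hm j
  have h := integral_cosh_norm_sum_le hX' (fun i => (hm i).const_smul l) (M := l * M)
    (s := l ^ 2 * s)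
    (fun i => (hb i).mono fun ω h => by
      rw [norm_smul, Real.norm_of_nonneg hl]; exact mul_le_mul_of_nonneg_left h hl) hM
    (fun i => by rw [integral_smul, h0, smul_zero])
    (fun i => by
      simp_rw [norm_smul, mul_pow, Real.norm_of_nonneg hl]
      rw [integral_const_mul]
      exact mul_le_mul_of_nonneg_left (h2 i) (sq_nonneg l)) (by positivity) Finset.univ
  simp_rw [← Finset.smul_sum, norm_smul, Real.norm_of_nonneg hl] at h
  have hcosh : Integrable (fun ω => Real.cosh (l * ‖∑ i, X i ω‖)) P := by
    refine Integrable.of_bound (Real.continuous_cosh.measurable.comp_aemeasurable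
      (hmS.norm.const_mul l)).aestronglyMeasurable (Real.cosh (l * (Fintype.card ι * M)))
      (hbT.mono fun ω hω => ?_)
    rw [Real.norm_of_nonneg (Real.cosh_pos _).le]
    have h5 : ‖∑ i, X i ω‖ ≤ Fintype.card ι * M :=
      (norm_sum_le_of_le _ fun i _ => hω i).trans (by simp)
    refine Real.cosh_le_cosh.2 ?_
    rw [abs_of_nonneg (by positivity), abs_of_nonneg (mul_nonneg hl ((norm_nonneg _).trans h5))]
    exact mul_le_mul_of_nonneg_left h5 hl
  have hint : Integrable (fun ω => Real.exp (l * ‖∑ i, X i ω‖)) P := by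
    refine Integrable.mono' (hcosh.const_mul 2) (Real.measurable_exp.comp_aemeasurable
      (hmS.norm.const_mul l)).aestronglyMeasurable (Filter.Eventually.of_forall fun ω => ?_)
    rw [Real.norm_of_nonneg (Real.exp_pos _).le, Real.cosh_eq]
    linarith [Real.exp_pos (-(l * ‖∑ i, X i ω‖))]
  have h3 := measure_ge_le_exp_mul_mgf (μ := P) (X := fun ω => ‖∑ i, X i ω‖) t hl hint
  -- The prefactor 2 of the final bound comes from exp ≤ 2 cosh, the price for working with an even
  -- function of the norm.
  have h4 : mgf (fun ω => ‖∑ i, X i ω‖) P l ≤ 2 * (1 + l ^ 2 * s) ^ Fintype.card ι := by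
    rw [mgf]
    calc ∫ ω, Real.exp (l * ‖∑ i, X i ω‖) ∂P ≤ ∫ ω, 2 * Real.cosh (l * ‖∑ i, X i ω‖) ∂P := by
          refine integral_mono hint (hcosh.const_mul 2) fun ω => ?_
          simp only [Real.cosh_eq]
          linarith [Real.exp_pos (-(l * ‖∑ i, X i ω‖))]
      _ ≤ _ := by
          rw [integral_const_mul]
          exact mul_le_mul_of_nonneg_left (by simpa using h) (by norm_num)
  refine h3.trans ?_
  rw [neg_mul, Real.exp_add, mul_left_comm 2]
  refine mul_le_mul_of_nonneg_left (h4.trans ?_) (Real.exp_pos _).le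
  refine mul_le_mul_of_nonneg_left ?_ (by norm_num)
  rw [Real.exp_nat_mul]
  exact pow_le_pow_left₀ (by positivity) (by linarith [Real.add_one_le_exp (l ^ 2 * s)]) _

end Concentration

namespace DictLearn

/-! ### Dominant coefficients and the gap condition. -/

section Coefficients

variable {K : ℕ}

/-- Coordinatewise multiplication, used for sign changes. -/
noncomputable def signMul (s : Fin K → ℝ) (x : Vec K) : Vec K := WithLp.toLp 2 fun k => s k * x k

/-- Permutation of the coordinates. -/
noncomputable def permute (p : Equiv.Perm (Fin K)) (x : Vec K) : Vec K :=
  WithLp.toLp 2 fun k => x (p k)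

/-- The indices with fewer than `S` strictly larger entries in absolute value. -/
noncomputable def topSet (S : ℕ) (x : Vec K) : Finset (Fin K) :=
  Finset.univ.filter fun k => (Finset.univ.filter fun j => |x k| < |x j|).card < S

@[simp] theorem signMul_apply (s : Fin K → ℝ) (x : Vec K) (k : Fin K) :
    signMul s x k = s k * x k := rfl

@[simp] theorem permute_apply (p : Equiv.Perm (Fin K)) (x : Vec K) (k : Fin K) :
    permute p x k = x (p k) := rfl

theorem mem_topSet {S : ℕ} {x : Vec K} {k : Fin K} :
    k ∈ topSet S x ↔ (Finset.univ.filter fun j => |x k| < |x j|).card < S := by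
  simp [topSet]

theorem abs_eq_one_of_sign {a : ℝ} (h : a = 1 ∨ a = -1) : |a| = 1 := by
  rcases h with rfl | rfl <;> simp

theorem topSet_signMul {S : ℕ} {s : Fin K → ℝ} (hs : ∀ k, s k = 1 ∨ s k = -1) (x : Vec K) :
    topSet S (signMul s x) = topSet S x := by
  ext k
  simp [mem_topSet, abs_mul, fun k => abs_eq_one_of_sign (hs k)]

theorem mem_topSet_permute {S : ℕ} {p : Equiv.Perm (Fin K)} {x : Vec K} {k : Fin K} :
    k ∈ topSet S (permute p x) ↔ p k ∈ topSet S x := by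
  rw [mem_topSet, mem_topSet]
  have : (Finset.univ.filter fun j => |x (p k)| < |x j|) =
      (Finset.univ.filter fun j => |permute p x k| < |permute p x j|).map p.toEmbedding := by
    ext j
    rw [Finset.mem_map_equiv, Finset.mem_filter, Finset.mem_filter]
    simp
  rw [this, Finset.card_map]

theorem measurableSet_mem_topSet (S : ℕ) (k : Fin K) :
    MeasurableSet {x : Vec K | k ∈ topSet S x} := by
  have h : Measurable fun x : Vec K =>
      ∑ j, if |x k| < |x j| then (1 : ℕ) else 0 := by
    refine Finset.measurable_fun_sum _ fun j _ => Measurable.ite ?_ measurable_const measurable_const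
    exact measurableSet_lt (by fun_prop) (by fun_prop)
  have e : {x : Vec K | k ∈ topSet S x} =
      {x | (∑ j, if |x k| < |x j| then (1 : ℕ) else 0) < S} := by
    ext x
    simp only [Set.mem_ofPred_eq, mem_topSet, Finset.card_filter]
  rw [e]
  exact measurableSet_lt h measurable_const

theorem measurable_signMul (s : Fin K → ℝ) : Measurable (signMul s) := by
  unfold signMul; fun_prop

theorem measurable_permute (p : Equiv.Perm (Fin K)) : Measurable (permute (K := K) p) := by
  unfold permute; fun_prop

/-- The sorting permutation of the absolute values makes them non-increasing. -/
theorem abs_sort_antitone (x : Vec K) :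
    Antitone fun i => |x (Tuple.sort (fun i => -|x i|) i)| := by
  intro i j hij
  have h := Tuple.monotone_sort (fun i => -|x i|) hij
  simp only [Function.comp_apply] at h
  exact neg_le_neg_iff.1 h

theorem rearr_succ {x : Vec K} (i : Fin K) :
    rearr x (i + 1) = |x (Tuple.sort (fun i => -|x i|) i)| := by
  simp [rearr]

theorem rearr_nonneg (x : Vec K) (j : ℕ) : 0 ≤ rearr x j := by
  unfold rearr; split_ifs <;> simp

theorem abs_le_rearr_one (x : Vec K) (k : Fin K) : |x k| ≤ rearr x 1 := by
  have hK : 0 < K := k.pos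
  have h := rearr_succ (x := x) ⟨0, hK⟩
  simp only [zero_add] at h
  rw [h]
  have := abs_sort_antitone x (show (⟨0, hK⟩ : Fin K) ≤
    (Tuple.sort (fun i => -|x i|)).symm k from Fin.mk_le_of_le_val (Nat.zero_le _))
  simpa using this

theorem exists_rearr_eq {j : ℕ} (hj : 1 ≤ j) (hjK : j ≤ K) (x : Vec K) :
    ∃ k, rearr x j = |x k| := by
  refine ⟨Tuple.sort (fun i => -|x i|) ⟨j - 1, by omega⟩, ?_⟩
  rw [← rearr_succ]; congr 1; simp; omega

/-- Links the rank description of the dominant set, which is manifestly measurable and equivariant,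
with the sorted one behind `rearr`. The strict gap rules out ties across position S. Positions of
the sorting permutation start at 0, so `i < S` means rank at most S. -/
theorem mem_topSet_sort {S : ℕ} {x : Vec K} (hgap : rearr x (S + 1) < rearr x S) (hS : 1 ≤ S)
    (hSK : S ≤ K) (i : Fin K) :
    Tuple.sort (fun i => -|x i|) i ∈ topSet S x ↔ (i : ℕ) < S := by
  set τ := Tuple.sort (fun i => -|x i|) with hτ
  have hanti := abs_sort_antitone x
  rw [← hτ] at hanti
  rw [mem_topSet]
  have hmap : (Finset.univ.filter fun j => |x (τ i)| < |x j|) =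
      (Finset.univ.filter fun j => |x (τ i)| < |x (τ j)|).map τ.toEmbedding := by
    ext j; simp
  rw [hmap, Finset.card_map]
  constructor
  · intro h
    by_contra hi
    push Not at hi
    have hsub : (Finset.univ.filter fun j : Fin K => (j : ℕ) < S) ⊆
        Finset.univ.filter fun j => |x (τ i)| < |x (τ j)| := by
      intro j hj
      simp only [Finset.mem_filter, Finset.mem_univ, true_and] at hj ⊢
      have hSK' : S < K := lt_of_le_of_lt hi i.2
      have h1 : |x (τ i)| ≤ rearr x (S + 1) := by
        have := rearr_succ (x := x) ⟨S, hSK'⟩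
        simp only at this
        rw [this, ← hτ]
        exact hanti (Fin.mk_le_of_le_val hi)
      have h2 : rearr x S ≤ |x (τ j)| := by
        have := rearr_succ (x := x) ⟨S - 1, by omega⟩
        simp only [Nat.sub_add_cancel hS] at this
        rw [this, ← hτ]
        exact hanti (Fin.le_def.2 (by simp; omega))
      linarith
    have hc := Finset.card_le_card hsub
    have : (Finset.univ.filter fun j : Fin K => (j : ℕ) < S).card = S := by
      rw [Fin.card_filter_val_lt]; omega
    omega
  · intro h
    have hsub : (Finset.univ.filter fun j => |x (τ i)| < |x (τ j)|) ⊆ Finset.Iio i := by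
      intro j hj
      simp only [Finset.mem_filter, Finset.mem_univ, true_and] at hj
      rw [Finset.mem_Iio]
      by_contra hji
      exact absurd (hanti (not_lt.1 hji)) (not_le.2 hj)
    have := Finset.card_le_card hsub
    rw [Fin.card_Iio] at this
    omega

/-- `topSet S x` collects the `S` largest entries of the unit vector `x`, which are separated from
the others by an absolute gap `β` and a relative gap `Δ`. -/
structure HasGap (S : ℕ) (β Δ : ℝ) (x : Vec K) : Prop where
  norm_eq : ‖x‖ = 1
  card_topSet : (topSet S x).card = S
  le_of_mem : ∀ k ∈ topSet S x, rearr x S ≤ |x k|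
  le_of_notMem : ∀ k ∉ topSet S x, |x k| ≤ rearr x (S + 1)
  absGap : β ≤ rearr x S - rearr x (S + 1)
  relGap : ∀ k, Δ * |x k| ≤ rearr x S - rearr x (S + 1)
  sum_topSet : ∑ k ∈ topSet S x, |x k| = ∑ j ∈ Finset.Icc 1 S, rearr x j

theorem HasGap.mk' {S : ℕ} {β Δ : ℝ} {x : Vec K} (hS : 1 ≤ S) (hSK : S ≤ K) (hx : ‖x‖ = 1)
    (hβ : 0 < β) (hΔ : 0 < Δ) (h1 : β ≤ rearr x S - rearr x (S + 1))
    (h2 : Δ ≤ (rearr x S - rearr x (S + 1)) / rearr x 1) : HasGap S β Δ x := by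
  have hgap : rearr x (S + 1) < rearr x S := by linarith
  -- If the largest entry were 0, the relative gap would be a division by zero with value 0,
  -- contradicting that it is at least Δ.
  have hpos : 0 < rearr x 1 := by
    rcases (rearr_nonneg x 1).eq_or_lt with h | h
    · rw [← h, div_zero] at h2; linarith
    · exact h
  have hτ := mem_topSet_sort hgap hS hSK
  set τ := Tuple.sort (fun i => -|x i|) with hτd
  have hanti := abs_sort_antitone x
  rw [← hτd] at hanti
  have htop : topSet S x = (Finset.univ.filter fun j : Fin K => (j : ℕ) < S).map τ.toEmbedding := by
    ext k
    obtain ⟨i, rfl⟩ := τ.surjective k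
    rw [hτ]
    simp
  refine ⟨hx, ?_, ?_, ?_, h1, fun k => ?_, ?_⟩
  · rw [htop, Finset.card_map, Fin.card_filter_val_lt]; omega
  · intro k hk
    obtain ⟨i, rfl⟩ := τ.surjective k
    rw [hτ] at hk
    have := rearr_succ (x := x) ⟨S - 1, by omega⟩
    simp only [Nat.sub_add_cancel hS] at this
    rw [this, ← hτd]
    exact hanti (Fin.le_def.2 (by simp; omega))
  · intro k hk
    obtain ⟨i, rfl⟩ := τ.surjective k
    rw [hτ, not_lt] at hk
    have := rearr_succ (x := x) ⟨S, lt_of_le_of_lt hk i.2⟩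
    simp only at this
    rw [this, ← hτd]
    exact hanti (Fin.mk_le_of_le_val hk)
  · rw [le_div_iff₀ hpos] at h2
    exact (mul_le_mul_of_nonneg_left (abs_le_rearr_one x k) hΔ.le).trans h2
  · rw [htop, Finset.sum_map]
    symm
    refine Finset.sum_bij' (fun j hj => (⟨j - 1, by simp at hj; omega⟩ : Fin K))
      (fun i _ => (i : ℕ) + 1) ?_ ?_ ?_ ?_ ?_
    · intro j hj; simp at hj ⊢; omega
    · intro i hi; simp at hi ⊢; omega
    · intro j hj; simp at hj ⊢; omega
    · intro i hi; simp
    · intro j hj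
      simp only [Finset.mem_Icc] at hj
      have := rearr_succ (x := x) ⟨j - 1, by omega⟩
      simp only [Nat.sub_add_cancel hj.1] at this
      rw [this]; rfl

theorem IsSparseLaw.ae_hasGap {ν : Measure (Vec K)} {S : ℕ} {β Δ : ℝ} (hν : IsSparseLaw ν S β Δ)
    (hS : 1 ≤ S) (hSK : S ≤ K) : ∀ᵐ x ∂ν, HasGap S β Δ x := by
  have h1 : ∀ᵐ x ∂ν, ¬ (rearr x S - rearr x (S + 1) < β) := ae_iff.2 (by simpa using hν.absGap)
  have h2 : ∀ᵐ x ∂ν, ¬ ((rearr x S - rearr x (S + 1)) / rearr x 1 < Δ) :=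
    ae_iff.2 (by simpa using hν.relGap)
  filter_upwards [h1, h2, hν.sphere] with x h1 h2 h3
  exact .mk' hS hSK h3 hν.gap_pos (hν.gap_pos.trans hν.gap_lt) (not_lt.1 h1) (not_lt.1 h2)

theorem HasGap.abs_le_one {S : ℕ} {β Δ : ℝ} {x : Vec K} (h : HasGap S β Δ x) (k : Fin K) :
    |x k| ≤ 1 := by
  rw [← h.norm_eq]; exact PiLp.norm_apply_le x k

theorem HasGap.rearr_le_one {S : ℕ} {β Δ : ℝ} {x : Vec K} (h : HasGap S β Δ x) {j : ℕ}
    (hj : 1 ≤ j) : rearr x j ≤ 1 := by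
  by_cases hK : j ≤ K
  · obtain ⟨k, hk⟩ := exists_rearr_eq hj hK x
    rw [hk]; exact h.abs_le_one k
  · have : rearr x j = 0 := by unfold rearr; rw [dif_neg (by omega)]
    rw [this]; exact zero_le_one

theorem HasGap.sum_sq {S : ℕ} {β Δ : ℝ} {x : Vec K} (h : HasGap S β Δ x) :
    ∑ k, x k ^ 2 = 1 := by
  have := EuclideanSpace.real_norm_sq_eq x
  rw [← this, h.norm_eq, one_pow]

end Coefficients

/-! ### Consequences of sign and permutation invariance: moments and subgaussian tails. -/

section Moments

variable {K : ℕ} {ν : Measure (Vec K)}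

theorem IsSignPermInvariant.integral_signMul (hν : IsSignPermInvariant ν) {E : Type*}
    [NormedAddCommGroup E] [NormedSpace ℝ E] {s : Fin K → ℝ} (hs : ∀ k, s k = 1 ∨ s k = -1)
    {f : Vec K → E} (hf : AEStronglyMeasurable f ν) :
    ∫ x, f (signMul s x) ∂ν = ∫ x, f x ∂ν := by
  have h : ν.map (signMul s) = ν := hν.sign s hs
  conv_rhs => rw [← h]
  rw [integral_map (measurable_signMul s).aemeasurable (by rwa [h])]

theorem IsSignPermInvariant.integral_permute (hν : IsSignPermInvariant ν) {E : Type*}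
    [NormedAddCommGroup E] [NormedSpace ℝ E] (p : Equiv.Perm (Fin K))
    {f : Vec K → E} (hf : AEStronglyMeasurable f ν) :
    ∫ x, f (permute p x) ∂ν = ∫ x, f x ∂ν := by
  have h : ν.map (permute p) = ν := hν.perm p
  conv_rhs => rw [← h]
  rw [integral_map (measurable_permute p).aemeasurable (by rwa [h])]

/-- The sign vector flipping the single coordinate `j`. -/
noncomputable def flip (j : Fin K) : Fin K → ℝ := fun k => if k = j then -1 else 1

theorem flip_sign (j k : Fin K) : flip j k = 1 ∨ flip j k = -1 := by
  unfold flip; split_ifs <;> simp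

theorem IsSignPermInvariant.integral_eq_zero_of_flip (hν : IsSignPermInvariant ν) (j : Fin K)
    {f : Vec K → ℝ} (hf : AEStronglyMeasurable f ν)
    (hodd : ∀ x, f (signMul (flip j) x) = -f x) : ∫ x, f x ∂ν = 0 := by
  have h := hν.integral_signMul (flip_sign j) hf
  simp_rw [hodd] at h
  rw [integral_neg] at h
  linarith

/-- The average of `h |x k|` over the top set, as an integral over a single coordinate. -/
theorem IsSparseLaw.card_mul_integral_topSet {S : ℕ} {β Δ : ℝ} (hν : IsSparseLaw ν S β Δ)
    (hS : 1 ≤ S) (hSK : S ≤ K) {h : ℝ → ℝ} (hh : Measurable h)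
    (hb : ∃ C, ∀ a, |a| ≤ 1 → |h (|a|)| ≤ C) (k : Fin K) :
    K * ∫ x, (if k ∈ topSet S x then h |x k| else 0) ∂ν =
      ∫ x, ∑ k ∈ topSet S x, h |x k| ∂ν := by
  have := hν.isProbabilityMeasure
  obtain ⟨C, hC⟩ := hb
  have hm : ∀ k, Measurable fun x : Vec K => if k ∈ topSet S x then h |x k| else 0 := fun k =>
    Measurable.ite (measurableSet_mem_topSet S k) (hh.comp (by fun_prop)) measurable_const
  have hi : ∀ k, Integrable (fun x : Vec K => if k ∈ topSet S x then h |x k| else 0) ν := by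
    intro k
    refine Integrable.of_bound (hm k).aestronglyMeasurable C ?_
    filter_upwards [hν.ae_hasGap hS hSK] with x hx
    have := hC (x k) (hx.abs_le_one k)
    split_ifs
    · exact this
    · simpa using (abs_nonneg _).trans this
  -- Transposing two coordinates maps the dominant set along with them, so every coordinate
  -- contributes equally.
  have heq : ∀ l, ∫ x, (if l ∈ topSet S x then h |x l| else 0) ∂ν =
      ∫ x, (if k ∈ topSet S x then h |x k| else 0) ∂ν := fun l => by
    rw [← hν.integral_permute (Equiv.swap k l) (hm k).aestronglyMeasurable]
    simp [mem_topSet_permute]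
  have hsum : ∀ x : Vec K, ∑ l ∈ topSet S x, h |x l| =
      ∑ l, if l ∈ topSet S x then h |x l| else 0 := fun x => by simp
  simp_rw [hsum]
  rw [integral_finsetSum _ fun l _ => hi l, Finset.sum_congr rfl fun l _ => heq l]
  simp

theorem IsSparseLaw.integral_mem_topSet {S : ℕ} {β Δ : ℝ} (hν : IsSparseLaw ν S β Δ)
    (hS : 1 ≤ S) (hSK : S ≤ K) (k : Fin K) :
    ∫ x, (if k ∈ topSet S x then (1 : ℝ) else 0) ∂ν = S / K := by
  have := hν.isProbabilityMeasure
  have hK : (K : ℝ) ≠ 0 := by have := k.pos; positivity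
  have h := hν.card_mul_integral_topSet hS hSK (h := fun _ => 1) measurable_const
    ⟨1, fun a _ => by simp⟩ k
  have h2 : ∫ x, ∑ k ∈ topSet S x, (1 : ℝ) ∂ν = S := by
    have : ∀ᵐ x ∂ν, ∑ k ∈ topSet S x, (1 : ℝ) = S := by
      filter_upwards [hν.ae_hasGap hS hSK] with x hx
      simp [hx.card_topSet]
    rw [integral_congr_ae this]; simp
  rw [h2] at h
  rw [eq_div_iff hK, mul_comm]; exact h

theorem IsSparseLaw.integral_abs_mem_topSet {S : ℕ} {β Δ : ℝ} (hν : IsSparseLaw ν S β Δ)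
    (hS : 1 ≤ S) (hSK : S ≤ K) (k : Fin K) :
    ∫ x, (if k ∈ topSet S x then |x k| else 0) ∂ν = gammaOne ν S / K := by
  have hK : (K : ℝ) ≠ 0 := by have := k.pos; positivity
  have h := hν.card_mul_integral_topSet hS hSK (h := fun a => a) measurable_id
    ⟨1, fun a h => by simpa using h⟩ k
  have h2 : ∫ x, ∑ k ∈ topSet S x, |x k| ∂ν = gammaOne ν S := by
    refine integral_congr_ae ?_
    filter_upwards [hν.ae_hasGap hS hSK] with x hx
    exact hx.sum_topSet
  rw [h2] at h
  rw [eq_div_iff hK, mul_comm]; exact h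

theorem IsSparseLaw.gammaOne_le {S : ℕ} {β Δ : ℝ} (hν : IsSparseLaw ν S β Δ)
    (hS : 1 ≤ S) (hSK : S ≤ K) : gammaOne ν S ≤ S := by
  have := hν.isProbabilityMeasure
  have h : ∀ᵐ x ∂ν, ‖∑ j ∈ Finset.Icc 1 S, rearr x j‖ ≤ S := by
    filter_upwards [hν.ae_hasGap hS hSK] with x hx
    refine (norm_sum_le _ _).trans ?_
    have : ∑ j ∈ Finset.Icc 1 S, ‖rearr x j‖ ≤ ∑ j ∈ Finset.Icc 1 S, (1 : ℝ) :=
      Finset.sum_le_sum fun j hj => by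
        rw [Real.norm_of_nonneg (rearr_nonneg x j)]
        exact hx.rearr_le_one (Finset.mem_Icc.1 hj).1
    simpa using this
  have := norm_integral_le_of_norm_le_const h
  simp only [probReal_univ, mul_one] at this
  exact (le_abs_self _).trans this

/-- A dominant entry is at least β, because it exceeds a nonnegative entry by the gap, and a given
coordinate is dominant with probability S/K. -/
theorem IsSparseLaw.gammaOne_pos {S : ℕ} {β Δ : ℝ} (hν : IsSparseLaw ν S β Δ)
    (hS : 1 ≤ S) (hSK : S ≤ K) : 0 < gammaOne ν S := by
  have := hν.isProbabilityMeasure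
  have hK : (0 : ℝ) < K := by have : 0 < K := by omega
                              positivity
  let k : Fin K := ⟨0, by omega⟩
  have h1 := hν.integral_abs_mem_topSet hS hSK k
  have h2 := hν.integral_mem_topSet hS hSK k
  have hm : Measurable fun x : Vec K => if k ∈ topSet S x then |x k| else 0 :=
    Measurable.ite (measurableSet_mem_topSet S k) (by fun_prop) measurable_const
  have hm1 : Measurable fun x : Vec K => if k ∈ topSet S x then (1 : ℝ) else 0 :=
    Measurable.ite (measurableSet_mem_topSet S k) (by fun_prop) measurable_const
  have h3 : β * (S / K) ≤ gammaOne ν S / K := by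
    rw [← h1, ← h2, ← integral_const_mul]
    refine integral_mono_ae ?_ ?_ ?_
    · refine (Integrable.of_bound hm1.aestronglyMeasurable 1 (.of_forall fun x => ?_)).const_mul β
      split_ifs <;> simp
    · refine Integrable.of_bound hm.aestronglyMeasurable 1 ?_
      filter_upwards [hν.ae_hasGap hS hSK] with x hx
      split_ifs
      · simpa using hx.abs_le_one k
      · simp
    · filter_upwards [hν.ae_hasGap hS hSK] with x hx
      split_ifs with h
      · have := hx.le_of_mem k h
        linarith [hx.absGap, rearr_nonneg x (S + 1)]
      · simp
  have hS' : (0 : ℝ) < S := by positivity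
  have : 0 < gammaOne ν S / K := lt_of_lt_of_le (mul_pos hν.gap_pos (by positivity)) h3
  exact (div_pos_iff_of_pos_right hK).1 this

/-- The gap is at most c_x(S), which is itself a nonzero |x k|; the relative gap at that entry gives
Δ|x k| ≤ |x k|. -/
theorem IsSparseLaw.relGap_le_one {S : ℕ} {β Δ : ℝ} (hν : IsSparseLaw ν S β Δ)
    (hS : 1 ≤ S) (hSK : S ≤ K) : Δ ≤ 1 := by
  have := hν.isProbabilityMeasure
  obtain ⟨x, hx⟩ := (hν.ae_hasGap hS hSK).exists
  obtain ⟨k, hk⟩ := exists_rearr_eq hS hSK x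
  have h1 := hx.relGap k
  have h2 := hx.absGap
  have h3 := rearr_nonneg x (S + 1)
  have h4 := hν.gap_pos
  rw [hk] at h1 h2
  have h5 : 0 < |x k| := by linarith
  nlinarith

/-- The moment generating function of a Rademacher sum, as a finite average. -/
theorem sum_signs_exp_eq (u : Fin K → ℝ) :
    ∑ s ∈ Fintype.piFinset (fun _ : Fin K => ({1, -1} : Finset ℝ)), Real.exp (∑ j, s j * u j) =
      2 ^ K * ∏ j, Real.cosh (u j) := by
  simp_rw [Real.exp_sum]
  rw [← Finset.prod_univ_sum (fun _ : Fin K => ({1, -1} : Finset ℝ)) fun j a => Real.exp (a * u j)]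
  have h : ∀ j, ∑ a ∈ ({1, -1} : Finset ℝ), Real.exp (a * u j) = 2 * Real.cosh (u j) := fun j => by
    rw [Finset.sum_pair (by norm_num), Real.cosh_eq]
    simp
    ring
  simp_rw [h]
  rw [Finset.prod_mul_distrib]
  simp

/-- Linear forms of a sign invariant vector, with a sign invariant weight, are subgaussian. -/
theorem IsSignPermInvariant.hasSubgaussianMGF (hν : IsSignPermInvariant ν) (a : Fin K → ℝ)
    {g : Vec K → ℝ} (hg : Measurable g)
    (hgs : ∀ s : Fin K → ℝ, (∀ k, s k = 1 ∨ s k = -1) → ∀ x, g (signMul s x) = g x)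
    {c : ℝ≥0} (hc : ∀ᵐ x ∂ν, ∑ j, (g x * x j * a j) ^ 2 ≤ c) :
    HasSubgaussianMGF (fun x => g x * ∑ j, x j * a j) c ν := by
  have := hν.isProbabilityMeasure
  have hX : Measurable fun x : Vec K => g x * ∑ j, x j * a j := by fun_prop
  have habs : ∀ᵐ x ∂ν, |g x * ∑ j, x j * a j| ≤ √(K * c) := by
    filter_upwards [hc] with x hx
    refine Real.abs_le_sqrt ?_
    rw [Finset.mul_sum]
    simp_rw [← mul_assoc]
    refine (sq_sum_le_card_mul_sum_sq).trans ?_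
    simp only [Finset.card_univ, Fintype.card_fin]
    exact mul_le_mul_of_nonneg_left hx (by positivity)
  have hi : ∀ t : ℝ, Integrable (fun x => Real.exp (t * (g x * ∑ j, x j * a j))) ν := fun t => by
    refine Integrable.of_bound (Real.measurable_exp.comp (hX.const_mul t)).aestronglyMeasurable
      (Real.exp (|t| * √(K * c))) ?_
    filter_upwards [habs] with x hx
    rw [Real.norm_of_nonneg (Real.exp_pos _).le]
    refine Real.exp_le_exp.2 ((le_abs_self _).trans ?_)
    rw [abs_mul]
    exact mul_le_mul_of_nonneg_left hx (abs_nonneg t)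
  refine ⟨hi, fun t => ?_⟩
  rw [mgf]
  set A := Fintype.piFinset (fun _ : Fin K => ({1, -1} : Finset ℝ)) with hA
  have hAs : ∀ s ∈ A, ∀ k, s k = 1 ∨ s k = -1 := fun s hs k => by
    simpa using Fintype.mem_piFinset.1 hs k
  have hcard : A.card = 2 ^ K := by
    rw [hA, Fintype.card_piFinset]
    simp [Finset.card_pair (show (1 : ℝ) ≠ -1 by norm_num)]
  -- By invariance the expectation may be averaged over all 2^K sign patterns. For fixed x this
  -- average is a product of cosh factors, each bounded by cosh u ≤ exp(u²/2). The weight g passes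
  -- through because sign changes do not affect it.
  have h1 : 2 ^ K * ∫ x, Real.exp (t * (g x * ∑ j, x j * a j)) ∂ν =
      ∫ x, ∑ s ∈ A, Real.exp (∑ j, s j * (t * (g x * x j * a j))) ∂ν := by
    have hform : ∀ s ∈ A, ∀ x, Real.exp (∑ j, s j * (t * (g x * x j * a j))) =
        (fun y : Vec K => Real.exp (t * (g y * ∑ j, y j * a j))) (signMul s x) := fun s hs x => by
      simp only [signMul_apply, hgs s (hAs s hs)]
      congr 1
      simp_rw [Finset.mul_sum]
      exact Finset.sum_congr rfl fun j _ => by ring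
    have hint : ∀ s ∈ A, Integrable
        (fun x => Real.exp (∑ j, s j * (t * (g x * x j * a j)))) ν := fun s hs => by
      simp_rw [hform s hs]
      have hmap : ν.map (signMul s) = ν := hν.sign s (hAs s hs)
      have := hi t
      rw [← hmap] at this
      exact this.comp_measurable (measurable_signMul s)
    rw [integral_finsetSum _ hint]
    rw [Finset.sum_congr rfl fun s hs => by
      simp_rw [hform s hs]
      rw [hν.integral_signMul (hAs s hs) (hi t).aestronglyMeasurable]]
    rw [Finset.sum_const, hcard]
    simp
  have h2 : ∀ᵐ x ∂ν, ∑ s ∈ A, Real.exp (∑ j, s j * (t * (g x * x j * a j))) ≤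
      2 ^ K * Real.exp (c * t ^ 2 / 2) := by
    filter_upwards [hc] with x hx
    rw [hA, sum_signs_exp_eq]
    refine mul_le_mul_of_nonneg_left ?_ (by positivity)
    calc ∏ j, Real.cosh (t * (g x * x j * a j))
        ≤ ∏ j, Real.exp ((t * (g x * x j * a j)) ^ 2 / 2) :=
          Finset.prod_le_prod (fun j _ => (Real.cosh_pos _).le) fun j _ =>
            Real.cosh_le_exp_half_sq _
      _ = Real.exp (t ^ 2 / 2 * ∑ j, (g x * x j * a j) ^ 2) := by
          rw [← Real.exp_sum, Finset.mul_sum]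
          congr 1
          exact Finset.sum_congr rfl fun j _ => by ring
      _ ≤ _ := by
          refine Real.exp_le_exp.2 ?_
          have := mul_le_mul_of_nonneg_left hx (show 0 ≤ t ^ 2 / 2 by positivity)
          linarith
  have h3 : ∫ x, ∑ s ∈ A, Real.exp (∑ j, s j * (t * (g x * x j * a j))) ∂ν ≤
      2 ^ K * Real.exp (c * t ^ 2 / 2) := by
    refine (integral_mono_of_nonneg (.of_forall fun x => Finset.sum_nonneg fun s _ =>
      (Real.exp_pos _).le) (integrable_const _) h2).trans ?_
    simp
  rw [← h1] at h3
  exact le_of_mul_le_mul_left h3 (by positivity)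

/-- The two-sided subgaussian tail, read as zero if the variance proxy vanishes. -/
theorem measureReal_lt_abs_le {Ω : Type*} [MeasurableSpace Ω] {μ : Measure Ω} [IsProbabilityMeasure μ]
    {X : Ω → ℝ} {c : ℝ≥0} (h : HasSubgaussianMGF X c μ) {m t : ℝ} (hm : c ≤ m) (ht : 0 < t) :
    μ.real {ω | t < |X ω|} ≤ 2 * (if m = 0 then 0 else Real.exp (-t ^ 2 / (2 * m))) := by
  split_ifs with h0
  · have hc : c = 0 := by
      have : (c : ℝ) ≤ 0 := by rw [← h0]; exact hm
      exact le_antisymm (by exact_mod_cast this) zero_le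
    subst hc
    have hX := h.ae_eq_zero_of_hasSubgaussianMGF_zero
    have : μ.real {ω | t < |X ω|} = 0 := by
      rw [measureReal_eq_zero_iff]
      refine measure_mono_null ?_ (ae_iff.1 hX)
      intro ω hω h2
      simp only [Pi.zero_apply] at h2
      rw [Set.mem_ofPred_eq, h2, abs_zero] at hω
      linarith
    rw [this]; simp
  · have hmp : 0 < m := lt_of_le_of_ne (c.2.trans hm) (Ne.symm h0)
    have h' : HasSubgaussianMGF X m.toNNReal μ := ⟨h.integrable_exp_mul, fun t =>
      (h.mgf_le t).trans (Real.exp_le_exp.2 (by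
        have := mul_le_mul_of_nonneg_right hm (sq_nonneg t)
        rw [Real.coe_toNNReal m hmp.le]
        linarith))⟩
    have h1 := h'.measure_ge_le ht.le
    have h2 := h'.neg.measure_ge_le ht.le
    simp only [Real.coe_toNNReal m hmp.le, Pi.neg_apply] at h1 h2
    have hsub : {ω | t < |X ω|} ⊆ {ω | t ≤ X ω} ∪ {ω | t ≤ -X ω} := fun ω hω => by
      rcases lt_abs.1 (show t < |X ω| from hω) with h | h
      · exact Or.inl h.le
      · exact Or.inr h.le
    have := (measureReal_mono (μ := μ) hsub).trans (measureReal_union_le _ _)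
    linarith

end Moments

/-! ### Norm, mean and second moment of the ideal summands. -/

section Signals

variable {d K : ℕ}

/-- Duality: the upper frame bound for the analysis operator is also one for its adjoint, by
Cauchy–Schwarz applied to ‖v‖² = ∑ x_k ⟨φ_k, v⟩. -/
theorem IsFrame.norm_sum_smul_sq_le {Φ : Dict d K} {A B : ℝ} (h : IsFrame Φ A B) (x : Vec K) :
    ‖∑ k, x k • Φ k‖ ^ 2 ≤ B * ‖x‖ ^ 2 := by
  set v := ∑ k, x k • Φ k with hv
  have hB : 0 < B := h.pos.trans_le h.le
  have h1 : ‖v‖ ^ 2 = ∑ k, x k * inner ℝ (Φ k) v := by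
    rw [← real_inner_self_eq_norm_sq]
    conv_lhs => rw [hv, sum_inner]
    simp_rw [real_inner_smul_left]
    rfl
  have h2 : (∑ k, x k * inner ℝ (Φ k) v) ^ 2 ≤ (∑ k, x k ^ 2) * ∑ k, (inner ℝ (Φ k) v) ^ 2 :=
    Finset.sum_mul_sq_le_sq_mul_sq _ _ _
  have h3 : ∑ k, (inner ℝ (Φ k) v) ^ 2 ≤ B * ‖v‖ ^ 2 := by simpa using h.upper v
  rw [← h1, ← EuclideanSpace.real_norm_sq_eq] at h2
  rcases eq_or_ne v 0 with h0 | h0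
  · have : 0 ≤ B * ‖x‖ ^ 2 := by positivity
    simpa [h0] using this
  have h4 : 0 < ‖v‖ ^ 2 := by have := norm_pos_iff.2 h0; positivity
  have h5 := h2.trans (mul_le_mul_of_nonneg_left h3 (sq_nonneg ‖x‖))
  refine le_of_mul_le_mul_right ?_ h4
  nlinarith

/-- With v = Φx one has (‖v‖ + ‖r‖)² ≤ (‖v‖² + 1)(1 + ‖r‖²), the defect being (‖v‖‖r‖ - 1)². The
normalisation of the signal thus bounds it whatever the size of the noise. -/
theorem IsFrame.norm_signal_le {Φ : Dict d K} {A B : ℝ} (h : IsFrame Φ A B) {x : Vec K}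
    (hx : ‖x‖ = 1) (r : Vec d) : ‖signal Φ x r‖ ≤ √(B + 1) := by
  have hB : 0 < B := h.pos.trans_le h.le
  have h1 := h.norm_sum_smul_sq_le x
  rw [hx] at h1
  have hpos : 0 < √(1 + ‖r‖ ^ 2) := Real.sqrt_pos.2 (by positivity)
  rw [signal, norm_smul, Real.norm_of_nonneg (by positivity), inv_mul_le_iff₀ hpos,
    ← Real.sqrt_mul (by positivity)]
  refine (norm_add_le _ _).trans (Real.le_sqrt_of_sq_le ?_)
  nlinarith [sq_nonneg (‖∑ k, x k • Φ k‖ * ‖r‖ - 1), norm_nonneg r,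
    norm_nonneg (∑ k, x k • Φ k), mul_le_mul_of_nonneg_right h1 (sq_nonneg ‖r‖)]

theorem IsFrame.one_le {Φ : Dict d K} {A B : ℝ} (h : IsFrame Φ A B) (hΦ : IsUnitNorm Φ)
    (k : Fin K) : 1 ≤ B := by
  have h1 := h.upper (Φ k)
  rw [hΦ k] at h1
  have h2 := Finset.single_le_sum (f := fun j => |inner ℝ (Φ j) (Φ k)| ^ 2)
    (fun j _ => sq_nonneg _) (Finset.mem_univ k)
  simp only [real_inner_self_eq_norm_sq, hΦ k] at h2
  norm_num at h1 h2
  linarith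

theorem measurable_signal (Φ : Dict d K) :
    Measurable fun z : Vec K × Vec d => signal Φ z.1 z.2 := by
  unfold signal
  refine (by fun_prop : Measurable fun z : Vec K × Vec d => (√(1 + ‖z.2‖ ^ 2))⁻¹).smul
    (Measurable.add ?_ measurable_snd)
  exact Finset.measurable_fun_sum _ fun k _ =>
    (by fun_prop : Measurable fun z : Vec K × Vec d => z.1 k).smul measurable_const

/-- The signal if atom `k` is among its `S` dominant ones, signed by the coefficient of this
atom. -/
noncomputable def signedSignal (S : ℕ) (Φ : Dict d K) (k : Fin K) (z : Vec K × Vec d) : Vec d :=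
  if k ∈ topSet S z.1 then Real.sign (z.1 k) • signal Φ z.1 z.2 else 0

theorem measurable_sign : Measurable Real.sign := by
  have : Real.sign = fun x : ℝ => if x < 0 then -1 else if 0 < x then 1 else 0 := rfl
  rw [this]
  exact Measurable.ite (measurableSet_lt measurable_id measurable_const) measurable_const
    (Measurable.ite (measurableSet_lt measurable_const measurable_id) measurable_const
      measurable_const)

theorem abs_sign_le_one (a : ℝ) : |Real.sign a| ≤ 1 := by
  rcases Real.sign_apply_eq a with h | h | h <;> rw [h] <;> simp

theorem measurable_signedSignal (S : ℕ) (Φ : Dict d K) (k : Fin K) :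
    Measurable (signedSignal S Φ k) := by
  unfold signedSignal
  refine Measurable.ite (measurable_fst (measurableSet_mem_topSet S k)) ?_ measurable_const
  exact (measurable_sign.comp (by fun_prop)).smul (measurable_signal Φ)

theorem IsFrame.norm_signedSignal_le {Φ : Dict d K} {A B : ℝ} (h : IsFrame Φ A B) (S : ℕ)
    (k : Fin K) {z : Vec K × Vec d} (hz : ‖z.1‖ = 1) : ‖signedSignal S Φ k z‖ ≤ √(B + 1) := by
  unfold signedSignal
  split_ifs
  · rw [norm_smul]
    have h1 := abs_sign_le_one (z.1 k)
    have h2 := h.norm_signal_le hz z.2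
    calc _ ≤ 1 * √(B + 1) := mul_le_mul h1 h2 (norm_nonneg _) zero_le_one
      _ = _ := one_mul _
  · simp

variable {ν : Measure (Vec K)} {η : Measure (Vec d)} {S : ℕ} {β Δ : ℝ}

theorem inv_sqrt_le_one (r : Vec d) : (√(1 + ‖r‖ ^ 2))⁻¹ ≤ 1 :=
  inv_le_one_of_one_le₀ (Real.one_le_sqrt.2 (by linarith [sq_nonneg ‖r‖]))

theorem integrable_inv_sqrt [IsProbabilityMeasure η] :
    Integrable (fun r : Vec d => (√(1 + ‖r‖ ^ 2))⁻¹) η := by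
  refine Integrable.of_bound (by fun_prop) 1 (.of_forall fun r => ?_)
  rw [Real.norm_of_nonneg (by positivity)]
  exact inv_sqrt_le_one r

theorem noiseConst_le_one [IsProbabilityMeasure η] : noiseConst η ≤ 1 := by
  have h := integral_mono (integrable_inv_sqrt (η := η)) (integrable_const (1 : ℝ))
    fun r => inv_sqrt_le_one r
  simpa [noiseConst] using h

theorem noiseConst_pos [IsProbabilityMeasure η] : 0 < noiseConst η := by
  unfold noiseConst
  rw [integral_pos_iff_support_of_nonneg (fun r => by positivity) integrable_inv_sqrt]
  have : Function.support (fun r : Vec d => (√(1 + ‖r‖ ^ 2))⁻¹) = Set.univ := by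
    ext r
    simp only [Function.mem_support, Set.mem_univ, iff_true]
    positivity
  rw [this, measure_univ]
  exact one_pos

theorem IsSparseLaw.integrable_of_le_one (hν : IsSparseLaw ν S β Δ) (hS : 1 ≤ S) (hSK : S ≤ K)
    {f : Vec K → ℝ} (hf : Measurable f) (hb : ∀ x, HasGap S β Δ x → |f x| ≤ 1) :
    Integrable f ν := by
  have := hν.isProbabilityMeasure
  exact Integrable.of_bound hf.aestronglyMeasurable 1 ((hν.ae_hasGap hS hSK).mono hb)

/-- Flipping x_j for j ≠ k kills the contribution of every other atom. Flipping x_k kills the noise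
term, as the sign in front of it has mean zero. What survives is E|x_k| over the event that k is
dominant, which is γ/K, times C_r. -/
theorem integral_signedSignal [IsProbabilityMeasure η] (hS : 1 ≤ S) (hSK : S ≤ K)
    (hν : IsSparseLaw ν S β Δ) (Φ : Dict d K) (k : Fin K) :
    ∫ z, signedSignal S Φ k z ∂(ν.prod η) = (noiseConst η * gammaOne ν S / K) • Φ k := by
  have := hν.isProbabilityMeasure
  set w : Vec d → ℝ := fun r => (√(1 + ‖r‖ ^ 2))⁻¹ with hw
  set c : Vec K → ℝ := fun x => if k ∈ topSet S x then Real.sign (x k) else 0 with hc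
  have hcm : Measurable c := Measurable.ite (measurableSet_mem_topSet S k)
    (measurable_sign.comp (by fun_prop)) measurable_const
  have hcb : ∀ x, |c x| ≤ 1 := fun x => by
    simp only [hc]; split_ifs
    · exact abs_sign_le_one _
    · simp
  have hform : ∀ z : Vec K × Vec d, signedSignal S Φ k z =
      ∑ j, (c z.1 * z.1 j) • (w z.2 • Φ j) + c z.1 • (w z.2 • z.2) := fun z => by
    simp only [signedSignal, signal, hc]
    split_ifs
    · simp only [smul_add, Finset.smul_sum, smul_smul]
      congr 1
      · exact Finset.sum_congr rfl fun j _ => by congr 1; ring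
    · simp
  have hxj : ∀ j, Integrable (fun x => c x * x j) ν := fun j =>
    hν.integrable_of_le_one hS hSK (by fun_prop) fun x hx => by
      rw [abs_mul]
      exact mul_le_one₀ (hcb x) (abs_nonneg _) (hx.abs_le_one j)
  have hwi : Integrable w η := integrable_inv_sqrt
  have hwr : Integrable (fun r => w r • r) η := by
    refine Integrable.of_bound (by fun_prop) 1 (.of_forall fun r => ?_)
    rw [norm_smul, Real.norm_of_nonneg (by positivity), inv_mul_le_iff₀ (by positivity), mul_one]
    exact Real.le_sqrt_of_sq_le (by linarith)
  have hci : Integrable c ν := hν.integrable_of_le_one hS hSK hcm fun x _ => hcb x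
  have hflip : ∀ j, j ≠ k → ∀ x, c (signMul (flip j) x) = c x := fun j hj x => by
    simp only [hc, topSet_signMul (flip_sign j), signMul_apply, flip, if_neg hj.symm, one_mul]
  have hflipk : ∀ x, c (signMul (flip k) x) = -c x := fun x => by
    simp only [hc, topSet_signMul (flip_sign k), signMul_apply, flip, if_true, neg_mul, one_mul,
      Real.sign_neg]
    split_ifs <;> simp
  have h0 : ∫ x, c x ∂ν = 0 :=
    hν.integral_eq_zero_of_flip k hcm.aestronglyMeasurable hflipk
  have h1 : ∀ j, j ≠ k → ∫ x, c x * x j ∂ν = 0 := fun j hj =>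
    hν.integral_eq_zero_of_flip j (hxj j).aestronglyMeasurable fun x => by
      rw [hflip j hj]; simp [flip]
  have h2 : ∫ x, c x * x k ∂ν = gammaOne ν S / K := by
    rw [← hν.integral_abs_mem_topSet hS hSK k]
    congr 1; ext x
    simp only [hc]; split_ifs
    · rcases lt_trichotomy (x k) 0 with h | h | h
      · rw [Real.sign_of_neg h, abs_of_neg h]; ring
      · rw [h]; simp
      · rw [Real.sign_of_pos h, abs_of_pos h]; ring
    · simp
  simp_rw [hform]
  have hI1 : ∀ j, Integrable (fun z : Vec K × Vec d => (c z.1 * z.1 j) • (w z.2 • Φ j))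
      (ν.prod η) := fun j => (hxj j).smul_prod (hwi.smul_const (Φ j))
  have hI2 : Integrable (fun z : Vec K × Vec d => c z.1 • (w z.2 • z.2)) (ν.prod η) :=
    hci.smul_prod hwr
  rw [integral_add (integrable_finsetSum _ fun j _ => hI1 j) hI2,
    integral_finsetSum _ fun j _ => hI1 j]
  have e1 : ∀ j, ∫ z : Vec K × Vec d, (c z.1 * z.1 j) • (w z.2 • Φ j) ∂(ν.prod η) =
      (∫ x, c x * x j ∂ν) • ((∫ r, w r ∂η) • Φ j) := fun j => by
    rw [← integral_smul_const w (Φ j)]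
    exact integral_prod_smul (μ := ν) (ν := η) (fun x => c x * x j) fun r => w r • Φ j
  have e2 : ∫ z : Vec K × Vec d, c z.1 • (w z.2 • z.2) ∂(ν.prod η) = 0 := by
    rw [integral_prod_smul (μ := ν) (ν := η) c fun r => w r • r, h0, zero_smul]
  rw [e2, add_zero, Finset.sum_eq_single k]
  · rw [e1, h2, smul_smul]
    congr 1
    simp only [noiseConst, hw]; ring
  · intro j _ hj
    rw [e1, h1 j hj, zero_smul]
  · simp

/-- Sign flips remove all off-diagonal terms, so only ∑ x_i² = 1 and ‖r‖² remain, and the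
normalisation makes them add up to 1 on the event that k is dominant. Hence the bound is the
probability S/K of that event, without any factor B. -/
theorem integral_norm_sq_signedSignal [IsProbabilityMeasure η] (hS : 1 ≤ S) (hSK : S ≤ K)
    (hν : IsSparseLaw ν S β Δ) {Φ : Dict d K} (hΦ : IsUnitNorm Φ) (k : Fin K) :
    ∫ z, ‖signedSignal S Φ k z‖ ^ 2 ∂(ν.prod η) ≤ S / K := by
  have := hν.isProbabilityMeasure
  set w : Vec d → ℝ := fun r => (1 + ‖r‖ ^ 2)⁻¹ with hw
  set c : Vec K → ℝ := fun x => if k ∈ topSet S x then 1 else 0 with hc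
  have hcm : Measurable c := Measurable.ite (measurableSet_mem_topSet S k)
    measurable_const measurable_const
  have hcb : ∀ x, |c x| ≤ 1 ∧ 0 ≤ c x := fun x => by
    simp only [hc]; split_ifs <;> simp
  have hflip : ∀ j x, c (signMul (flip j) x) = c x := fun j x => by
    simp only [hc, topSet_signMul (flip_sign j)]
  have hle : ∀ z : Vec K × Vec d, ‖signedSignal S Φ k z‖ ^ 2 ≤
      ∑ i, ∑ j, (c z.1 * (z.1 i * z.1 j)) * (w z.2 * inner ℝ (Φ i) (Φ j)) +
      ∑ j, (c z.1 * z.1 j) * (w z.2 * (2 * inner ℝ (Φ j) z.2)) + c z.1 * (w z.2 * ‖z.2‖ ^ 2) := by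
    intro z
    have hn : ‖signedSignal S Φ k z‖ ^ 2 ≤ c z.1 * ‖signal Φ z.1 z.2‖ ^ 2 := by
      simp only [signedSignal, hc]
      split_ifs
      · rw [one_mul, norm_smul, mul_pow, Real.norm_eq_abs]
        have := abs_sign_le_one (z.1 k)
        have h1 : |Real.sign (z.1 k)| ^ 2 ≤ 1 := pow_le_one₀ (abs_nonneg _) this
        nlinarith [sq_nonneg ‖signal Φ z.1 z.2‖]
      · simp
    refine hn.trans (le_of_eq ?_)
    have hs : ‖signal Φ z.1 z.2‖ ^ 2 = w z.2 * ‖(∑ k, z.1 k • Φ k) + z.2‖ ^ 2 := by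
      rw [signal, norm_smul, mul_pow, norm_inv, inv_pow, Real.norm_of_nonneg (Real.sqrt_nonneg _),
        Real.sq_sqrt (by positivity)]
    have hv : ‖∑ k, z.1 k • Φ k‖ ^ 2 = ∑ i, ∑ j, z.1 i * z.1 j * inner ℝ (Φ i) (Φ j) := by
      rw [← real_inner_self_eq_norm_sq, sum_inner]
      refine Finset.sum_congr rfl fun i _ => ?_
      rw [inner_sum]
      refine Finset.sum_congr rfl fun j _ => ?_
      rw [real_inner_smul_left, real_inner_smul_right]; ring
    rw [hs, norm_add_sq_real, hv, sum_inner]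
    simp only [real_inner_smul_left, mul_add, Finset.mul_sum]
    congr 1
    congr 1
    · exact Finset.sum_congr rfl fun i _ => Finset.sum_congr rfl fun j _ => by ring
    · exact Finset.sum_congr rfl fun i _ => by ring
  have hxj : ∀ j, Integrable (fun x => c x * x j) ν := fun j =>
    hν.integrable_of_le_one hS hSK (by fun_prop) fun x hx => by
      rw [abs_mul]
      exact mul_le_one₀ (hcb x).1 (abs_nonneg _) (hx.abs_le_one j)
  have hxij : ∀ i j, Integrable (fun x => c x * (x i * x j)) ν := fun i j =>
    hν.integrable_of_le_one hS hSK (by fun_prop) fun x hx => by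
      rw [abs_mul, abs_mul]
      exact mul_le_one₀ (hcb x).1 (by positivity)
        (mul_le_one₀ (hx.abs_le_one i) (abs_nonneg _) (hx.abs_le_one j))
  have hci : Integrable c ν := hν.integrable_of_le_one hS hSK hcm fun x _ => (hcb x).1
  have hwb : ∀ r, 0 ≤ w r ∧ w r ≤ 1 := fun r =>
    ⟨by positivity, inv_le_one_of_one_le₀ (by linarith [sq_nonneg ‖r‖])⟩
  have hwi : Integrable w η := by
    refine Integrable.of_bound (by fun_prop) 1 (.of_forall fun r => ?_)
    rw [Real.norm_of_nonneg (hwb r).1]; exact (hwb r).2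
  -- Signal energy and noise energy add up to exactly 1 after normalisation.
  have hw2 : ∀ r, w r + w r * ‖r‖ ^ 2 = 1 := fun r => by
    simp only [hw]
    have : (1 + ‖r‖ ^ 2) ≠ 0 := by positivity
    field_simp
  have hwr2 : Integrable (fun r => w r * ‖r‖ ^ 2) η := by
    refine Integrable.of_bound (by fun_prop) 1 (.of_forall fun r => ?_)
    rw [Real.norm_of_nonneg (mul_nonneg (hwb r).1 (sq_nonneg _))]
    linarith [hw2 r, (hwb r).1]
  have hwr : ∀ j, Integrable (fun r => w r * (2 * inner ℝ (Φ j) r)) η := fun j => by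
    refine Integrable.of_bound (by fun_prop) 1 (.of_forall fun r => ?_)
    have h1 : |inner ℝ (Φ j) r| ≤ ‖r‖ := by
      simpa [hΦ j] using abs_real_inner_le_norm (Φ j) r
    rw [Real.norm_eq_abs, abs_mul, abs_mul, abs_of_nonneg (hwb r).1, abs_two]
    have h2 : 2 * ‖r‖ ≤ 1 + ‖r‖ ^ 2 := by nlinarith [sq_nonneg (‖r‖ - 1)]
    have h3 := mul_le_mul_of_nonneg_left ((mul_le_mul_of_nonneg_left h1 zero_le_two).trans h2)
      (hwb r).1
    linarith [hw2 r]
  have hI1 : ∀ i j, Integrable (fun z : Vec K × Vec d =>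
      (c z.1 * (z.1 i * z.1 j)) * (w z.2 * inner ℝ (Φ i) (Φ j))) (ν.prod η) := fun i j =>
    (hxij i j).mul_prod (hwi.mul_const _)
  have hI2 : ∀ j, Integrable (fun z : Vec K × Vec d =>
      (c z.1 * z.1 j) * (w z.2 * (2 * inner ℝ (Φ j) z.2))) (ν.prod η) := fun j =>
    (hxj j).mul_prod (hwr j)
  have hI3 : Integrable (fun z : Vec K × Vec d => c z.1 * (w z.2 * ‖z.2‖ ^ 2)) (ν.prod η) :=
    hci.mul_prod hwr2
  have hS1 := integrable_finsetSum Finset.univ fun i _ =>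
    integrable_finsetSum Finset.univ fun j _ => hI1 i j
  have hS2 := integrable_finsetSum Finset.univ fun j _ => hI2 j
  refine (integral_mono_of_nonneg (.of_forall fun z => sq_nonneg _) ((hS1.add hS2).add hI3)
    (.of_forall hle)).trans (le_of_eq ?_)
  have hc1 : ∫ x, c x ∂ν = S / K := hν.integral_mem_topSet hS hSK k
  have e1 : ∀ i j, ∫ z : Vec K × Vec d,
      (c z.1 * (z.1 i * z.1 j)) * (w z.2 * inner ℝ (Φ i) (Φ j)) ∂(ν.prod η) =
      if i = j then (∫ x, c x * (x i * x i) ∂ν) * ∫ r, w r ∂η else 0 := fun i j => by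
    rw [integral_prod_mul (fun x : Vec K => c x * (x i * x j))
      fun r : Vec d => w r * inner ℝ (Φ i) (Φ j)]
    split_ifs with h
    · subst h
      simp [hΦ i]
    · rw [hν.integral_eq_zero_of_flip i (hxij i j).aestronglyMeasurable fun x => ?_, zero_mul]
      rw [hflip]; simp [flip, Ne.symm h]
  have e2 : ∀ j, ∫ z : Vec K × Vec d,
      (c z.1 * z.1 j) * (w z.2 * (2 * inner ℝ (Φ j) z.2)) ∂(ν.prod η) = 0 := fun j => by
    rw [integral_prod_mul (fun x : Vec K => c x * x j)
      fun r : Vec d => w r * (2 * inner ℝ (Φ j) r)]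
    rw [hν.integral_eq_zero_of_flip j (hxj j).aestronglyMeasurable fun x => ?_, zero_mul]
    rw [hflip]; simp [flip]
  have e3 : ∑ i, ∫ x, c x * (x i * x i) ∂ν = S / K := by
    rw [← integral_finsetSum _ fun i _ => hxij i i, ← hc1]
    refine integral_congr_ae ?_
    filter_upwards [hν.ae_hasGap hS hSK] with x hx
    rw [← Finset.mul_sum]
    simp_rw [← sq]
    rw [hx.sum_sq, mul_one]
  rw [integral_add' (hS1.add hS2) hI3, integral_add' hS1 hS2,
    integral_finsetSum _ fun i _ => integrable_finsetSum Finset.univ fun j _ => hI1 i j,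
    integral_finsetSum _ fun j _ => hI2 j,
    integral_prod_mul c fun r : Vec d => w r * ‖r‖ ^ 2]
  simp_rw [integral_finsetSum Finset.univ fun j _ => hI1 _ j, e1, e2]
  simp only [Finset.sum_ite_eq, Finset.mem_univ, if_true, Finset.sum_const_zero, add_zero]
  rw [← Finset.sum_mul, e3, hc1, ← mul_add, ← integral_add hwi hwr2]
  simp_rw [hw2]
  simp

end Signals

/-! ### Recovery of the dominant atoms and their signs by thresholding. -/

section Recovery

variable {d K : ℕ}

/-- Inner products with the other atoms. -/
noncomputable def crossGram (Φ : Dict d K) (k j : Fin K) : ℝ :=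
  if j = k then 0 else inner ℝ (Φ k) (Φ j)

/-- The component of the atom `Ψ k` orthogonal to `Φ k`. -/
noncomputable def residual (Φ Ψ : Dict d K) (k : Fin K) : Vec d :=
  Ψ k - (inner ℝ (Ψ k) (Φ k) : ℝ) • Φ k

/-- The pairs of coefficients and noise for which the cross terms, the perturbation of the
dictionary or the noise may be too large for the recovery of the support. -/
def badSet (Φ Ψ : Dict d K) (β Δ : ℝ) : Set (Vec K × Vec d) :=
  {z | ∃ k, β / 7 < |∑ j, z.1 j * crossGram Φ k j| ∨
    Δ / 7 < |‖z.1.ofLp‖⁻¹ * ∑ j, z.1 j * inner ℝ (residual Φ Ψ k) (Φ j)| ∨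
    β / 7 < |inner ℝ (Ψ k) z.2|}

theorem abs_crossGram_le (Φ : Dict d K) (k j : Fin K) : crossGram Φ k j ^ 2 ≤ coherence Φ ^ 2 := by
  unfold crossGram
  split_ifs with h
  · rw [zero_pow two_ne_zero]; positivity
  · have h1 : |inner ℝ (Φ k) (Φ j)| ≤ coherence Φ :=
      le_ciSup (f := fun p : {p : Fin K × Fin K // p.1 ≠ p.2} => |inner ℝ (Φ p.1.1) (Φ p.1.2)|)
        (Set.finite_range _).bddAbove ⟨(k, j), Ne.symm h⟩
    rw [← sq_abs]
    exact pow_le_pow_left₀ (abs_nonneg _) h1 2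

theorem inner_eq_of_unit {u v : Vec d} (hu : ‖u‖ = 1) (hv : ‖v‖ = 1) :
    inner ℝ v u = 1 - ‖u - v‖ ^ 2 / 2 := by
  rw [norm_sub_sq_real, hu, hv, real_inner_comm]; ring

/-- For unit vectors at distance t the inner product is 1 - t²/2, so Pythagoras gives t² - t⁴/4. -/
theorem norm_residual_sq_le {Φ Ψ : Dict d K} (hΦ : IsUnitNorm Φ) (hΨ : IsUnitNorm Ψ) {δ : ℝ}
    {k : Fin K} (h : ‖Φ k - Ψ k‖ ≤ δ) : ‖residual Φ Ψ k‖ ^ 2 ≤ δ ^ 2 := by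
  have h1 : ‖residual Φ Ψ k‖ ^ 2 = 1 - (inner ℝ (Ψ k) (Φ k)) ^ 2 := by
    rw [residual, norm_sub_sq_real, hΨ k, norm_smul, mul_pow, hΦ k, real_inner_smul_right,
      Real.norm_eq_abs, sq_abs]
    ring
  have h2 := pow_le_pow_left₀ (norm_nonneg _) h 2
  rw [h1, inner_eq_of_unit (hΦ k) (hΨ k)]
  nlinarith [sq_nonneg (‖Φ k - Ψ k‖ ^ 2)]

/-- Split ψ_k along φ_k and its orthogonal complement. The first part yields the coefficient and the
coherence interference, the second the interference due to the perturbation of the dictionary. -/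
theorem inner_sum_eq {Φ : Dict d K} (hΦ : IsUnitNorm Φ) (Ψ : Dict d K) (x : Vec K) (k : Fin K) :
    inner ℝ (Ψ k) (∑ j, x j • Φ j) = inner ℝ (Ψ k) (Φ k) * x k +
      inner ℝ (Ψ k) (Φ k) * (∑ j, x j * crossGram Φ k j) +
      ∑ j, x j * inner ℝ (residual Φ Ψ k) (Φ j) := by
  rw [inner_sum]
  have h : ∀ j, inner ℝ (Ψ k) (x j • Φ j) =
      (if j = k then inner ℝ (Ψ k) (Φ k) * x j else 0) +
      inner ℝ (Ψ k) (Φ k) * (x j * crossGram Φ k j) +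
      x j * inner ℝ (residual Φ Ψ k) (Φ j) := fun j => by
    rw [residual, inner_sub_left, real_inner_smul_left, real_inner_smul_right, crossGram]
    split_ifs with h
    · subst h
      rw [real_inner_self_eq_norm_sq, hΦ j]; ring
    · ring
  simp_rw [h]
  rw [Finset.sum_add_distrib, Finset.sum_add_distrib, ← Finset.mul_sum]
  simp

/-- A set of the right size on which the summands are larger than off it is the maximiser. -/
theorem eq_of_isMax {S : ℕ} {f : Fin K → ℝ} {I T : Finset (Fin K)} (hI : I.card = S)
    (hT : T.card = S) (hmax : ∀ J : Finset (Fin K), J.card = S → ∑ k ∈ J, f k ≤ ∑ k ∈ I, f k)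
    (hlt : ∀ k ∈ T, ∀ l ∉ T, f l < f k) : I = T := by
  by_contra hne
  have h1 : ¬ T ⊆ I := fun h => hne (Finset.eq_of_subset_of_card_le h (by omega)).symm
  have h2 : ¬ I ⊆ T := fun h => hne (Finset.eq_of_subset_of_card_le h (by omega))
  obtain ⟨k, hkT, hkI⟩ := Finset.not_subset.1 h1
  obtain ⟨l, hlI, hlT⟩ := Finset.not_subset.1 h2
  have hk : k ∉ I.erase l := fun h => hkI (Finset.mem_of_mem_erase h)
  -- Exchange argument: trading l for k keeps the size and would increase the sum.
  have h3 := hmax (insert k (I.erase l)) (by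
    rw [Finset.card_insert_of_notMem hk, Finset.card_erase_of_mem hlI]
    have := Finset.card_pos.2 ⟨l, hlI⟩
    omega)
  rw [Finset.sum_insert hk, ← Finset.add_sum_erase I f hlI] at h3
  linarith [hlt k hkT l hlT]

/-- `x.ofLp` is a plain function, so its norm is the sup norm, that is c_x(1), and not the Euclidean
norm. -/
theorem norm_ofLp_le_of_relGap {S : ℕ} {β Δ : ℝ} {x : Vec K} (hx : HasGap S β Δ x) (hβ : 0 < β)
    (hΔ : 0 < Δ) : Δ * ‖x.ofLp‖ ≤ rearr x S - rearr x (S + 1) := by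
  have hg : 0 ≤ rearr x S - rearr x (S + 1) := hβ.le.trans hx.absGap
  rw [mul_comm, ← le_div_iff₀ hΔ, pi_norm_le_iff_of_nonneg (by positivity)]
  intro k
  rw [le_div_iff₀ hΔ, mul_comm]
  exact hx.relGap k

/-- Off the bad set the responses of the atoms are dominated by their coefficients. -/
theorem abs_inner_sub_le {Φ Ψ : Dict d K} (hΦ : IsUnitNorm Φ) (hΨ : IsUnitNorm Ψ) {S : ℕ}
    {β Δ : ℝ} (hβ : 0 < β) (hΔ : 0 < Δ) {z : Vec K × Vec d} (hz : HasGap S β Δ z.1)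
    (hbad : z ∉ badSet Φ Ψ β Δ) (k : Fin K) :
    |inner ℝ (Ψ k) ((∑ j, z.1 j • Φ j) + z.2) - inner ℝ (Ψ k) (Φ k) * z.1 k| ≤
      3 / 7 * (rearr z.1 S - rearr z.1 (S + 1)) := by
  have hb : ∀ k, |∑ j, z.1 j * crossGram Φ k j| ≤ β / 7 ∧
    |‖z.1.ofLp‖⁻¹ * ∑ j, z.1 j * inner ℝ (residual Φ Ψ k) (Φ j)| ≤ Δ / 7 ∧
    |inner ℝ (Ψ k) z.2| ≤ β / 7 := by
    simpa [badSet] using hbad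
  obtain ⟨h1, h2, h3⟩ := hb k
  have hα : |inner ℝ (Ψ k) (Φ k)| ≤ 1 := by
    simpa [hΦ k, hΨ k] using abs_real_inner_le_norm (Ψ k) (Φ k)
  have hrel := norm_ofLp_le_of_relGap hz hβ hΔ
  have habs := hz.absGap
  set g := rearr z.1 S - rearr z.1 (S + 1)
  have hpos : 0 < ‖z.1.ofLp‖ := by
    rw [norm_pos_iff]
    intro h0
    have : z.1 = 0 := by ext k; rw [h0]; rfl
    have := hz.norm_eq
    simp_all
  have h4 : |∑ j, z.1 j * inner ℝ (residual Φ Ψ k) (Φ j)| ≤ g / 7 := by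
    rw [abs_mul, abs_of_pos (inv_pos.2 hpos), inv_mul_le_iff₀ hpos] at h2
    linarith
  have h5 : |inner ℝ (Ψ k) (Φ k) * (∑ j, z.1 j * crossGram Φ k j)| ≤ g / 7 := by
    rw [abs_mul]
    calc _ ≤ 1 * |∑ j, z.1 j * crossGram Φ k j| :=
          mul_le_mul_of_nonneg_right hα (abs_nonneg _)
      _ ≤ _ := by linarith
  rw [inner_add_right, inner_sum_eq hΦ]
  rw [abs_le] at *
  constructor <;> linarith [h3.1, h3.2, h4.1, h4.2, h5.1, h5.2]

theorem sign_mul_of_sign {s a : ℝ} (hs : s = 1 ∨ s = -1) : Real.sign (s * a) = s * Real.sign a := by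
  rcases hs with rfl | rfl <;> simp [Real.sign_neg]

theorem sign_mul_of_pos {c a : ℝ} (hc : 0 < c) : Real.sign (c * a) = Real.sign a := by
  rcases lt_trichotomy a 0 with h | h | h
  · rw [Real.sign_of_neg h, Real.sign_of_neg (mul_neg_of_pos_of_neg hc h)]
  · rw [h, mul_zero]
  · rw [Real.sign_of_pos h, Real.sign_of_pos (mul_pos hc h)]

theorem sign_eq_of_abs_sub_lt {a b : ℝ} (h : |a - b| < |b|) : Real.sign a = Real.sign b := by
  rcases lt_trichotomy b 0 with hb | hb | hb
  · rw [abs_of_neg hb, abs_lt] at h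
    rw [Real.sign_of_neg hb, Real.sign_of_neg (by linarith [h.2])]
  · rw [hb, abs_zero] at h; exact absurd h (not_lt.2 (abs_nonneg _))
  · rw [abs_of_pos hb, abs_lt] at h
    rw [Real.sign_of_pos hb, Real.sign_of_pos (by linarith [h.1])]

/-- The dictionary `Ψ`, after a permutation and sign changes of its atoms. -/
noncomputable def realign (Ψ : Dict d K) (p : Equiv.Perm (Fin K)) (s : Fin K → ℝ) : Dict d K :=
  fun k => s k • Ψ (p k)

theorem isUnitNorm_realign {Ψ : Dict d K} (hΨ : IsUnitNorm Ψ) (p : Equiv.Perm (Fin K))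
    {s : Fin K → ℝ} (hs : ∀ k, s k = 1 ∨ s k = -1) : IsUnitNorm (realign Ψ p s) := fun k => by
  rw [realign, norm_smul, Real.norm_eq_abs, abs_eq_one_of_sign (hs k), hΨ, one_mul]

/-- The contribution of a signal to the signed signal mean of atom `k`. -/
noncomputable def contribution (sel : Dict d K → Vec d → Finset (Fin K)) (Ψ : Dict d K)
    (y : Vec d) (k : Fin K) : Vec d :=
  if k ∈ sel Ψ y then Real.sign (inner ℝ (Ψ k) y) • y else 0

/-- Off the bad set, thresholding recovers the dominant atoms together with their signs. -/
theorem contribution_eq_signedSignal {Φ Ψ : Dict d K} (hΦ : IsUnitNorm Φ) (hΨ : IsUnitNorm Ψ)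
    {p : Equiv.Perm (Fin K)} {s : Fin K → ℝ} (hs : ∀ k, s k = 1 ∨ s k = -1) {S : ℕ}
    {sel : Dict d K → Vec d → Finset (Fin K)} (hsel : IsThresholding S sel)
    {β Δ δ : ℝ} (hβ : 0 < β) (hΔ : 0 < Δ) (hΔ1 : Δ ≤ 1) (hδ : δ ^ 2 ≤ Δ / 8)
    (hdist : ∀ k, ‖Φ k - realign Ψ p s k‖ ≤ δ)
    {z : Vec K × Vec d} (hz : HasGap S β Δ z.1)
    (hbad : z ∉ badSet Φ (realign Ψ p s) β Δ) (k : Fin K) :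
    s k • contribution sel Ψ (signal Φ z.1 z.2) (p k) = signedSignal S Φ k z := by
  set Ψ' := realign Ψ p s with hΨ'd
  have hΨ' : IsUnitNorm Ψ' := isUnitNorm_realign hΨ p hs
  set y := signal Φ z.1 z.2 with hy
  set v := (∑ j, z.1 j • Φ j) + z.2 with hv
  set c := (√(1 + ‖z.2‖ ^ 2))⁻¹ with hc
  have hcpos : 0 < c := by positivity
  have hyv : y = c • v := rfl
  have herr := abs_inner_sub_le hΦ hΨ' hβ hΔ hz hbad
  have habs := hz.absGap
  have hrel := hz.relGap
  have hmem := hz.le_of_mem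
  have hnot := hz.le_of_notMem
  have hnn := rearr_nonneg z.1 (S + 1)
  set g := rearr z.1 S - rearr z.1 (S + 1) with hg
  have hα : ∀ k, 1 - Δ / 16 ≤ inner ℝ (Ψ' k) (Φ k) ∧ inner ℝ (Ψ' k) (Φ k) ≤ 1 := fun k => by
    have h2 := pow_le_pow_left₀ (norm_nonneg _) (hdist k) 2
    rw [inner_eq_of_unit (hΦ k) (hΨ' k)]
    constructor
    · linarith
    · linarith [sq_nonneg ‖Φ k - Ψ' k‖]
  -- Since ⟨ψ_k, φ_k⟩ ≥ 1 - Δ/16 and Δ|x_k| ≤ g, replacing the inner product by 1 costs at most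
  -- g/16.
  have hαx : ∀ k, |inner ℝ (Ψ' k) (Φ k) * z.1 k| ≤ |z.1 k| ∧
      |z.1 k| - g / 16 ≤ |inner ℝ (Ψ' k) (Φ k) * z.1 k| := fun k => by
    obtain ⟨h1, h2⟩ := hα k
    have h3 := abs_nonneg (z.1 k)
    have h4 := hrel k
    rw [abs_mul, abs_of_nonneg (by linarith : 0 ≤ inner ℝ (Ψ' k) (Φ k))]
    constructor <;> nlinarith
  have hpos : 0 < g := hβ.trans_le habs
  -- The two responses start a gap g apart. Errors of 3g/7 on each side and the loss g/16 leave
  -- g(1/7 - 1/16) > 0.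
  have hlt : ∀ k ∈ topSet S z.1, ∀ l ∉ topSet S z.1, |inner ℝ (Ψ' l) v| < |inner ℝ (Ψ' k) v| := by
    intro k hk l hl
    have h1 := abs_sub_abs_le_abs_sub (inner ℝ (Ψ' l) v) (inner ℝ (Ψ' l) (Φ l) * z.1 l)
    have h2 := abs_sub_abs_le_abs_sub (inner ℝ (Ψ' k) (Φ k) * z.1 k) (inner ℝ (Ψ' k) v)
    rw [abs_sub_comm] at h2
    linarith [herr k, herr l, hαx k, hαx l, (hαx k).2, (hαx l).1, hmem k hk, hnot l hl]
  have habsin : ∀ k, |inner ℝ (Ψ (p k)) y| = c * |inner ℝ (Ψ' k) v| := fun k => by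
    rw [hyv, real_inner_smul_right, abs_mul, abs_of_pos hcpos]
    simp only [hΨ'd, realign]
    rw [real_inner_smul_left, abs_mul, abs_eq_one_of_sign (hs k), one_mul]
  have hselT : sel Ψ y = (topSet S z.1).map p.toEmbedding := by
    refine eq_of_isMax (f := fun k => |inner ℝ (Ψ k) y|) (hsel.card Ψ y)
      (by rw [Finset.card_map, hz.card_topSet]) (hsel.isMax Ψ y) ?_
    intro k hk l hl
    obtain ⟨k, rfl⟩ := p.surjective k
    obtain ⟨l, rfl⟩ := p.surjective l
    simp only [Finset.mem_map_equiv, Equiv.symm_apply_apply] at hk hl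
    rw [habsin, habsin]
    exact mul_lt_mul_of_pos_left (hlt k hk l hl) hcpos
  rw [contribution, signedSignal, hselT, ← hy]
  simp only [Finset.mem_map_equiv, Equiv.symm_apply_apply]
  split_ifs with h
  · rw [smul_smul, ← sign_mul_of_sign (hs k), ← real_inner_smul_left]
    congr 1
    change Real.sign (inner ℝ (Ψ' k) y) = _
    rw [hyv, real_inner_smul_right, sign_mul_of_pos hcpos]
    have h1 : Real.sign (inner ℝ (Ψ' k) v) = Real.sign (inner ℝ (Ψ' k) (Φ k) * z.1 k) := by
      -- A dominant coefficient has modulus at least c_x(S) ≥ g, so its response cannot change sign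
      -- under an error of 3g/7.
      refine sign_eq_of_abs_sub_lt ((herr k).trans_lt ?_)
      linarith [(hαx k).2, hmem k h]
    rw [h1, sign_mul_of_pos (by linarith [(hα k).1])]
  · rw [smul_zero]

theorem norm_contribution_le (sel : Dict d K → Vec d → Finset (Fin K)) (Ψ : Dict d K)
    (y : Vec d) (k : Fin K) : ‖contribution sel Ψ y k‖ ≤ ‖y‖ := by
  unfold contribution
  split_ifs
  · rw [norm_smul]
    calc _ ≤ 1 * ‖y‖ := mul_le_mul_of_nonneg_right (abs_sign_le_one _) (norm_nonneg _)
      _ = _ := one_mul _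
  · simp

theorem measurableSet_badSet (Φ Ψ : Dict d K) (β Δ : ℝ) : MeasurableSet (badSet Φ Ψ β Δ) := by
  unfold badSet
  rw [Set.ofPred_exists]
  refine MeasurableSet.iUnion fun k => ?_
  have h1 : Measurable fun z : Vec K × Vec d => |∑ j, z.1 j * crossGram Φ k j| := by fun_prop
  have h2 : Measurable fun z : Vec K × Vec d =>
      |‖z.1.ofLp‖⁻¹ * ∑ j, z.1 j * inner ℝ (residual Φ Ψ k) (Φ j)| := by fun_prop
  have h3 : Measurable fun z : Vec K × Vec d => |inner ℝ (Ψ k) z.2| := by fun_prop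
  exact (measurableSet_lt measurable_const h1).union
    ((measurableSet_lt measurable_const h2).union (measurableSet_lt measurable_const h3))

/-- The probability of the bad set. -/
theorem measureReal_badSet_le {ν : Measure (Vec K)} {η : Measure (Vec d)} {S : ℕ} {β Δ : ℝ}
    (hS : 1 ≤ S) (hSK : S ≤ K) (hν : IsSparseLaw ν S β Δ) {ρ : ℝ≥0}
    (hη : IsSubgaussianNoise η ρ) {Φ Ψ : Dict d K} {A B : ℝ} (hframe : IsFrame Φ A B)
    (hΦ : IsUnitNorm Φ) (hΨ : IsUnitNorm Ψ) {δ : ℝ} (hδ : 0 < δ)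
    (hdist : ∀ k, ‖Φ k - Ψ k‖ ≤ δ) :
    (ν.prod η).real (badSet Φ Ψ β Δ) ≤
      K * (4 * (if max (coherence Φ ^ 2) ((ρ : ℝ) ^ 2) = 0 then 0 else
        Real.exp (-β ^ 2 / (98 * max (coherence Φ ^ 2) ((ρ : ℝ) ^ 2)))) +
        2 * Real.exp (-Δ ^ 2 / (98 * (B * δ ^ 2)))) := by
  have := hν.isProbabilityMeasure
  have := hη.isProbabilityMeasure
  have hB : 0 < B := hframe.pos.trans_le hframe.le
  set m := max (coherence Φ ^ 2) ((ρ : ℝ) ^ 2) with hm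
  have hΔ : 0 < Δ := hν.gap_pos.trans hν.gap_lt
  have hfst : (ν.prod η).map Prod.fst = ν := by simp
  have hsnd : (ν.prod η).map Prod.snd = η := by simp
  have h1 : ∀ k, (ν.prod η).real {z | β / 7 < |∑ j, z.1 j * crossGram Φ k j|} ≤
      2 * (if m = 0 then 0 else Real.exp (-β ^ 2 / (98 * m))) := fun k => by
    have hs := hν.hasSubgaussianMGF (crossGram Φ k) (g := fun _ => 1) measurable_const
      (fun _ _ _ => rfl) (c := (coherence Φ ^ 2).toNNReal) (by
        filter_upwards [hν.ae_hasGap hS hSK] with x hx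
        rw [Real.coe_toNNReal _ (sq_nonneg _)]
        calc ∑ j, (1 * x j * crossGram Φ k j) ^ 2
            ≤ ∑ j, x j ^ 2 * coherence Φ ^ 2 := Finset.sum_le_sum fun j _ => by
              rw [one_mul, mul_pow]
              exact mul_le_mul_of_nonneg_left (abs_crossGram_le Φ k j) (sq_nonneg _)
          _ = _ := by rw [← Finset.sum_mul, hx.sum_sq, one_mul])
    rw [← hfst] at hs
    have hs' := hs.of_map (Y := Prod.fst) measurable_fst.aemeasurable
    have := measureReal_lt_abs_le hs' (m := m) (t := β / 7)
      (by rw [Real.coe_toNNReal _ (sq_nonneg _)]; exact le_max_left _ _)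
      (by linarith [hν.gap_pos])
    -- The constant 98 = 2 · 7² comes from the seventh shares of the gap in the subgaussian
    -- exponent.
    have e : -(β / 7) ^ 2 / (2 * m) = -β ^ 2 / (98 * m) := by ring
    rw [e] at this
    simpa [Function.comp_def] using this
  have h3 : ∀ k, (ν.prod η).real {z | β / 7 < |inner ℝ (Ψ k) z.2|} ≤
      2 * (if m = 0 then 0 else Real.exp (-β ^ 2 / (98 * m))) := fun k => by
    have hs := hη.subgaussian (Ψ k) (hΨ k)
    rw [← hsnd] at hs
    have hs' := hs.of_map (Y := Prod.snd) measurable_snd.aemeasurable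
    have := measureReal_lt_abs_le hs' (m := m) (t := β / 7)
      (by rw [NNReal.coe_pow]; exact le_max_right _ _) (by linarith [hν.gap_pos])
    have e : -(β / 7) ^ 2 / (2 * m) = -β ^ 2 / (98 * m) := by ring
    rw [e] at this
    simpa [Function.comp_def] using this
  have h2 : ∀ k, (ν.prod η).real
      {z | Δ / 7 < |‖z.1.ofLp‖⁻¹ * ∑ j, z.1 j * inner ℝ (residual Φ Ψ k) (Φ j)|} ≤
      2 * Real.exp (-Δ ^ 2 / (98 * (B * δ ^ 2))) := fun k => by
    have hBδ : 0 < B * δ ^ 2 := by positivity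
    -- Dividing by the sup norm makes all coefficients at most 1 in modulus, so the upper frame
    -- bound on the residual gives the variance proxy B δ². This matches the relative gap, which is
    -- also measured against c_x(1).
    have hs := hν.hasSubgaussianMGF (fun j => inner ℝ (residual Φ Ψ k) (Φ j))
      (g := fun x => ‖x.ofLp‖⁻¹) (by fun_prop)
      (fun s hs x => by
        have : ‖(signMul s x).ofLp‖ = ‖x.ofLp‖ := by
          simp only [Pi.norm_def, NNReal.coe_inj]
          refine Finset.sup_congr rfl fun k _ => ?_
          rw [signMul_apply, ← NNReal.coe_inj, coe_nnnorm, coe_nnnorm, norm_mul, Real.norm_eq_abs,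
            abs_eq_one_of_sign (hs k), one_mul]
        rw [this]) (c := (B * δ ^ 2).toNNReal) (by
        refine .of_forall fun x => ?_
        rw [Real.coe_toNNReal _ hBδ.le]
        calc ∑ j, (‖x.ofLp‖⁻¹ * x j * inner ℝ (residual Φ Ψ k) (Φ j)) ^ 2
            ≤ ∑ j, |inner ℝ (Φ j) (residual Φ Ψ k)| ^ 2 := Finset.sum_le_sum fun j _ => by
              have h4 : |‖x.ofLp‖⁻¹ * x j| ≤ 1 := by
                rw [abs_mul, abs_inv, abs_norm]
                exact inv_mul_le_one_of_le₀ (norm_le_pi_norm x.ofLp j) (norm_nonneg _)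
              have h5 : (‖x.ofLp‖⁻¹ * x j) ^ 2 ≤ 1 := by
                rw [← sq_abs]; exact pow_le_one₀ (abs_nonneg _) h4
              rw [mul_pow, sq_abs, real_inner_comm]
              nlinarith [sq_nonneg (inner ℝ (Φ j) (residual Φ Ψ k))]
          _ ≤ B * ‖residual Φ Ψ k‖ ^ 2 := hframe.upper _
          _ ≤ _ := mul_le_mul_of_nonneg_left (norm_residual_sq_le hΦ hΨ (hdist k)) hB.le)
    rw [← hfst] at hs
    have hs' := hs.of_map (Y := Prod.fst) measurable_fst.aemeasurable
    have := measureReal_lt_abs_le hs' (m := B * δ ^ 2) (t := Δ / 7)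
      (by rw [Real.coe_toNNReal _ hBδ.le]) (by linarith)
    have e : -(Δ / 7) ^ 2 / (2 * (B * δ ^ 2)) = -Δ ^ 2 / (98 * (B * δ ^ 2)) := by ring
    rw [e, if_neg hBδ.ne'] at this
    simpa [Function.comp_def] using this
  have hsub : badSet Φ Ψ β Δ ⊆ ⋃ k ∈ (Finset.univ : Finset (Fin K)),
      ({z : Vec K × Vec d | β / 7 < |∑ j, z.1 j * crossGram Φ k j|} ∪
      ({z | Δ / 7 < |‖z.1.ofLp‖⁻¹ * ∑ j, z.1 j * inner ℝ (residual Φ Ψ k) (Φ j)|} ∪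
      {z | β / 7 < |inner ℝ (Ψ k) z.2|})) := by
    rintro z ⟨k, hk⟩
    exact Set.mem_biUnion (Finset.mem_coe.2 (Finset.mem_univ k)) hk
  refine (measureReal_mono hsub (measure_ne_top _ _)).trans ((measureReal_biUnion_finset_le _ _).trans ?_)
  refine (Finset.sum_le_card_nsmul _ _ (4 * (if m = 0 then 0 else
        Real.exp (-β ^ 2 / (98 * m))) + 2 * Real.exp (-Δ ^ 2 / (98 * (B * δ ^ 2))))
        fun k _ => ?_).trans ?_
  · refine (measureReal_union_le _ _).trans ?_
    have := measureReal_union_le (μ := ν.prod η)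
      {z : Vec K × Vec d | Δ / 7 < |‖z.1.ofLp‖⁻¹ * ∑ j, z.1 j * inner ℝ (residual Φ Ψ k) (Φ j)|}
      {z | β / 7 < |inner ℝ (Ψ k) z.2|}
    linarith [h1 k, h2 k, h3 k]
  · rw [Finset.card_univ, Fintype.card_fin, nsmul_eq_mul]

end Recovery

/-! ### Numerical consequences of the convergence radius. -/

section Radius

/-- The ranges of the parameters entering the convergence radius. -/
structure Admissible (K S : ℕ) (B C γ Δ : ℝ) : Prop where
  one_le_S : 1 ≤ S
  S_le : S ≤ K
  one_le_B : 1 ≤ B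
  C_pos : 0 < C
  C_le : C ≤ 1
  γ_pos : 0 < γ
  γ_le : γ ≤ S
  Δ_pos : 0 < Δ
  Δ_le : Δ ≤ 1

variable {K S : ℕ} {B C γ Δ : ℝ}

theorem Admissible.one_le_K (h : Admissible K S B C γ Δ) : (1 : ℝ) ≤ K := by
  exact_mod_cast h.one_le_S.trans h.S_le

theorem Admissible.γ_le_K (h : Admissible K S B C γ Δ) : γ ≤ K :=
  h.γ_le.trans (by exact_mod_cast h.S_le)

theorem Admissible.C_mul_γ_le (h : Admissible K S B C γ Δ) : C * γ ≤ S :=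
  (mul_le_of_le_one_left h.γ_pos.le h.C_le).trans h.γ_le

theorem Admissible.arg_ge (h : Admissible K S B C γ Δ) :
    2120 ≤ 1060 * (K : ℝ) ^ 2 * (B + 1) / (Δ * C * γ) := by
  have h1 := h.one_le_K
  have h2 := h.γ_le_K
  have hΔ := h.Δ_pos
  have hC := h.C_pos
  have hγ := h.γ_pos
  rw [le_div_iff₀ (by positivity)]
  have h3 : Δ * C * γ ≤ 1 * 1 * K := by
    gcongr
    · exact h.Δ_le
    · exact h.C_le
  have h4 : (K : ℝ) ≤ (K : ℝ) ^ 2 := by nlinarith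
  have h5 := h.one_le_B
  nlinarith

/-- The logarithm is at least 4, because its argument is at least 2120 and e⁴ ≤ 81. -/
theorem Admissible.two_le_sqrt_log (h : Admissible K S B C γ Δ) :
    2 ≤ √(Real.log (1060 * (K : ℝ) ^ 2 * (B + 1) / (Δ * C * γ))) := by
  refine Real.le_sqrt_of_sq_le ?_
  have h1 := h.arg_ge
  rw [Real.le_log_iff_exp_le (by linarith)]
  have h2 : Real.exp (2 ^ 2) = Real.exp 1 ^ 4 := by rw [← Real.exp_nat_mul]; norm_num
  have h3 : Real.exp 1 ^ 4 ≤ 3 ^ 4 :=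
    pow_le_pow_left₀ (Real.exp_pos _).le (by linarith [Real.exp_one_lt_d9]) 4
  rw [h2]; linarith

theorem Admissible.convRadius_pos (h : Admissible K S B C γ Δ) : 0 < convRadius K B C γ Δ := by
  have h1 := h.two_le_sqrt_log
  have h2 := h.one_le_B
  have h3 := h.Δ_pos
  unfold convRadius
  positivity

/-- From 98 (1/4 + 2)² = 496.125. -/
theorem Admissible.convRadius_sq_mul_le (h : Admissible K S B C γ Δ) :
    496 * B * convRadius K B C γ Δ ^ 2 ≤ Δ ^ 2 := by
  have h1 := h.two_le_sqrt_log
  have h2 := h.one_le_B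
  have h3 := h.Δ_pos
  unfold convRadius
  set s := √(Real.log (1060 * (K : ℝ) ^ 2 * (B + 1) / (Δ * C * γ)))
  rw [div_pow, mul_pow, Real.sq_sqrt (by positivity)]
  rw [← mul_div_assoc, div_le_iff₀ (by positivity)]
  have h4 : 496 ≤ 98 * (1 / 4 + s) ^ 2 := by nlinarith
  have h5 : 0 ≤ Δ ^ 2 * B := by positivity
  nlinarith

/-- The first bound keeps the normalisation loss small, the second is what support recovery needs,
and the third keeps the Bernstein parameter and the Chernoff exponent in range. -/
theorem Admissible.le_of_le_convRadius (h : Admissible K S B C γ Δ) {a : ℝ} (ha : 0 < a)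
    (haR : a ≤ convRadius K B C γ Δ) :
    a ≤ 9 / 200 ∧ a ^ 2 ≤ Δ / 8 ∧ a * √(B + 1) ≤ 1 / 15 := by
  have h1 := h.convRadius_sq_mul_le
  have h2 := h.one_le_B
  have h3 := h.Δ_pos
  have h4 := h.Δ_le
  have h5 : a ^ 2 ≤ convRadius K B C γ Δ ^ 2 := pow_le_pow_left₀ ha.le haR 2
  have h6 : 496 * (B * a ^ 2) ≤ Δ ^ 2 := by nlinarith
  have h7 : Δ ^ 2 ≤ Δ := by nlinarith
  have h8 : a ^ 2 ≤ B * a ^ 2 := by nlinarith [sq_nonneg a]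
  refine ⟨?_, by linarith, ?_⟩
  · refine (abs_le_of_sq_le_sq' ?_ (by norm_num)).2
    nlinarith
  · refine (abs_le_of_sq_le_sq' ?_ (by norm_num)).2
    rw [mul_pow, Real.sq_sqrt (by linarith)]
    nlinarith

/-- Monotonicity without derivatives: v/u ≤ 1 + (v² - u²) ≤ exp(v² - u²) as soon as u ≥ 1. -/
theorem mul_exp_neg_sq_le {u v : ℝ} (hu : 1 ≤ u) (huv : u ≤ v) :
    v * Real.exp (-v ^ 2) ≤ u * Real.exp (-u ^ 2) := by
  have h1 : v / u ≤ Real.exp (v ^ 2 - u ^ 2) := by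
    refine le_trans ?_ (Real.add_one_le_exp _)
    rw [div_le_iff₀ (by linarith)]
    nlinarith [mul_nonneg (sub_nonneg.2 hu) (sub_nonneg.2 huv), mul_nonneg (sub_nonneg.2 huv)
      (mul_nonneg (by linarith : 0 ≤ u) (by linarith : 0 ≤ v))]
  rw [div_le_iff₀ (by linarith)] at h1
  have h2 : Real.exp (-u ^ 2) = Real.exp (v ^ 2 - u ^ 2) * Real.exp (-v ^ 2) := by
    rw [← Real.exp_add]; ring_nf
  rw [h2]
  have := mul_le_mul_of_nonneg_right h1 (Real.exp_pos (-v ^ 2)).le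
  linarith

/-- Within the convergence radius the failures caused by the perturbation of the dictionary
contribute little. -/
theorem Admissible.perturbation_le (h : Admissible K S B C γ Δ) {a : ℝ} (ha : 0 < a)
    (haR : a ≤ convRadius K B C γ Δ) :
    4 * (K : ℝ) ^ 2 * √(B + 1) * Real.exp (-Δ ^ 2 / (98 * (B * a ^ 2))) ≤ 2 / 25 * a * (C * γ) := by
  have hs := h.two_le_sqrt_log
  have hX := h.arg_ge
  have hB := h.one_le_B
  have hΔ := h.Δ_pos
  have hC := h.C_pos
  have hγ := h.γ_pos
  have hK := h.one_le_K
  unfold convRadius at haR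
  set X := 1060 * (K : ℝ) ^ 2 * (B + 1) / (Δ * C * γ) with hXd
  set s := √(Real.log X) with hsd
  set b := √(98 * B) with hb
  have hbpos : 0 < b := Real.sqrt_pos.2 (by positivity)
  have hb2 : b ^ 2 = 98 * B := Real.sq_sqrt (by positivity)
  have hlog : s ^ 2 = Real.log X := Real.sq_sqrt (Real.log_nonneg (by linarith))
  have hXpos : 0 < X := by linarith
  set v := Δ / (b * a) with hv
  -- The failure probability is exp(-v²) with v proportional to 1/a. A bound on v exp(-v²) is
  -- therefore a bound linear in a, as a contraction requires.
  have huv : 1 / 4 + s ≤ v := by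
    rw [le_div_iff₀ (by positivity)] at haR ⊢
    linarith
  have h1 := mul_exp_neg_sq_le (by linarith : 1 ≤ 1 / 4 + s) huv
  -- The summand 1/4 in the radius leaves the spare factor exp(-(1/16 + s/2)) besides exp(-s²) =
  -- 1/X, which absorbs the prefactor 1/4 + s.
  have h2 : (1 / 4 + s) * Real.exp (-(1 / 4 + s) ^ 2) ≤ 2 / X := by
    have e : Real.exp (-(1 / 4 + s) ^ 2) = Real.exp (-(1 / 16 + s / 2)) / X := by
      rw [show -(1 / 4 + s) ^ 2 = -(1 / 16 + s / 2) + -Real.log X by rw [← hlog]; ring,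
        Real.exp_add, Real.exp_neg (Real.log X), Real.exp_log hXpos, ← div_eq_mul_inv]
    rw [e, ← mul_div_assoc]
    gcongr
    rw [Real.exp_neg, ← div_eq_mul_inv, div_le_iff₀ (Real.exp_pos _)]
    have := Real.add_one_le_exp (1 / 16 + s / 2)
    linarith
  have h3 : -v ^ 2 = -Δ ^ 2 / (98 * (B * a ^ 2)) := by
    rw [hv, div_pow, mul_pow, hb2]; ring
  rw [h3] at h1
  set e := Real.exp (-Δ ^ 2 / (98 * (B * a ^ 2))) with he
  have h4 : v * e ≤ 2 / X := h1.trans h2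
  have h5 : Δ * e ≤ 2 * (Δ * C * γ) / (1060 * (K : ℝ) ^ 2 * (B + 1)) * (b * a) := by
    have h6 : 2 / X = 2 * (Δ * C * γ) / (1060 * (K : ℝ) ^ 2 * (B + 1)) := by
      rw [hXd, div_div_eq_mul_div]
    rw [h6, hv, div_mul_eq_mul_div, div_le_iff₀ (by positivity)] at h4
    exact h4
  have h7 : e * (1060 * (K : ℝ) ^ 2 * (B + 1)) ≤ 2 * (C * γ) * (b * a) := by
    rw [div_mul_eq_mul_div, le_div_iff₀ (by positivity)] at h5
    refine le_of_mul_le_mul_left ?_ hΔ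
    linarith
  have h8 : b ≤ 10 * √(B + 1) := by
    rw [hb, show (10 : ℝ) = √(100) by rw [show (100 : ℝ) = 10 ^ 2 by norm_num]; simp,
      ← Real.sqrt_mul (by norm_num)]
    exact Real.sqrt_le_sqrt (by linarith)
  have h9 : √(B + 1) ^ 2 = B + 1 := Real.sq_sqrt (by linarith)
  have h10 : 0 < √(B + 1) := Real.sqrt_pos.2 (by linarith)
  set q := √(B + 1)
  rw [← h9] at h7
  have h11 : 2 * (C * γ) * (b * a) ≤ 2 * (C * γ) * (10 * q * a) := by gcongr
  have h12 : q * (e * (1060 * (K : ℝ) ^ 2 * q)) ≤ q * (2 * (C * γ) * (10 * a)) := by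
    calc _ = e * (1060 * (K : ℝ) ^ 2 * q ^ 2) := by ring
      _ ≤ _ := h7.trans h11
      _ = _ := by ring
  have h13 := le_of_mul_le_mul_left h12 h10
  have h14 : 0 < C * γ * a := by positivity
  -- The remaining constant is 4 · 20/1060 < 2/25.
  nlinarith

/-! ### Normalisation, and neighbourhoods of Φ up to permutation and sign. -/

variable {d : ℕ}

/-- Normalising a vector close to a positive multiple of a unit vector. -/
theorem norm_normalize_sub_le {u w : Vec d} (hu : ‖u‖ = 1) {c t : ℝ} (hc : 0 < c) (ht1 : t < 1)
    (h : ‖w - c • u‖ ≤ c * t) : 0 < ‖w‖ ∧ ‖‖w‖⁻¹ • w - u‖ ^ 2 ≤ t ^ 2 / (1 - t) := by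
  have h1 : c * (1 - t) ≤ ‖w‖ := by
    have := norm_sub_norm_le (c • u) w
    rw [norm_smul, hu, mul_one, Real.norm_of_nonneg hc.le, norm_sub_rev] at this
    linarith
  have hw : 0 < ‖w‖ := lt_of_lt_of_le (mul_pos hc (by linarith)) h1
  refine ⟨hw, ?_⟩
  have h2 := pow_le_pow_left₀ (norm_nonneg _) h 2
  rw [norm_sub_sq_real, norm_smul, hu, mul_one, Real.norm_of_nonneg hc.le,
    real_inner_smul_right] at h2
  rw [norm_sub_sq_real, norm_smul, hu, real_inner_smul_left, norm_inv, norm_norm,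
    inv_mul_cancel₀ hw.ne', le_div_iff₀ (by linarith)]
  set n := ‖w‖
  set i := inner ℝ w u
  have h3 : (1 ^ 2 - 2 * (n⁻¹ * i) + 1 ^ 2) * n = 2 * n - 2 * i := by field_simp; ring
  -- Here n² + c² ≥ 2cn linearises the squared hypothesis; the radial error is discarded, so
  -- normalising costs only a factor 1/(1 - t) in the square.
  have h4 : c * (2 * n - 2 * i) ≤ c * (c * t ^ 2) := by nlinarith [sq_nonneg (n - c)]
  have h5 := le_of_mul_le_mul_left h4 hc
  have h6 : 0 ≤ 1 ^ 2 - 2 * (n⁻¹ * i) + 1 ^ 2 := by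
    have : |i| ≤ n := by simpa [hu] using abs_real_inner_le_norm w u
    have h7 : n⁻¹ * i ≤ 1 := by rw [inv_mul_le_iff₀ hw, mul_one]; exact (le_abs_self _).trans this
    linarith
  set D := 1 ^ 2 - 2 * (n⁻¹ * i) + 1 ^ 2
  rw [← h3] at h5
  have h8 : D * (c * (1 - t)) ≤ D * n := mul_le_mul_of_nonneg_left h1 h6
  have h9 : c * (D * (1 - t)) ≤ c * t ^ 2 := by linarith
  exact le_of_mul_le_mul_left h9 hc

/-- The unit norm dictionaries within symmetric distance `a` of `Φ`. -/
def nearSet (Φ : Dict d K) (a : ℝ) : Set (Dict d K) :=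
  {Ψ | (∀ k, ‖Ψ k‖ = 1) ∧ ∃ p : Equiv.Perm (Fin K), ∀ k, atomDist (Φ k) (Ψ (p k)) ≤ a}

theorem nearSet_mono {Φ : Dict d K} {a b : ℝ} (hab : a ≤ b) : nearSet Φ a ⊆ nearSet Φ b :=
  fun _ ⟨h1, p, h2⟩ => ⟨h1, p, fun k => (h2 k).trans hab⟩

theorem measurableSet_nearSet (Φ : Dict d K) (a : ℝ) : MeasurableSet (nearSet Φ a) := by
  unfold nearSet atomDist
  refine IsClosed.measurableSet (IsClosed.inter ?_ ?_)
  · have : {Ψ : Dict d K | ∀ k, ‖Ψ k‖ = 1} = ⋂ k, {Ψ : Dict d K | ‖Ψ k‖ = 1} := by ext; simp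
    change IsClosed {Ψ : Dict d K | ∀ k, ‖Ψ k‖ = 1}
    rw [this]
    exact isClosed_iInter fun k => isClosed_eq (by fun_prop) continuous_const
  · have : {Ψ : Dict d K | ∃ p : Equiv.Perm (Fin K), ∀ k,
        min ‖Φ k - Ψ (p k)‖ ‖Φ k + Ψ (p k)‖ ≤ a} =
        ⋃ p : Equiv.Perm (Fin K), ⋂ k, {Ψ | min ‖Φ k - Ψ (p k)‖ ‖Φ k + Ψ (p k)‖ ≤ a} := by
      ext; simp
    change IsClosed {Ψ : Dict d K | ∃ p : Equiv.Perm (Fin K), ∀ k,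
        min ‖Φ k - Ψ (p k)‖ ‖Φ k + Ψ (p k)‖ ≤ a}
    rw [this]
    exact isClosed_iUnion_of_finite fun p => isClosed_iInter fun k =>
      isClosed_le (by fun_prop) continuous_const

theorem exists_realign_of_mem_nearSet {Φ Ψ : Dict d K} {a : ℝ} (h : Ψ ∈ nearSet Φ a) :
    ∃ (p : Equiv.Perm (Fin K)) (s : Fin K → ℝ), (∀ k, s k = 1 ∨ s k = -1) ∧
      ∀ k, ‖Φ k - realign Ψ p s k‖ ≤ a := by
  obtain ⟨-, p, hp⟩ := h
  have : ∀ k, ∃ s : ℝ, (s = 1 ∨ s = -1) ∧ ‖Φ k - s • Ψ (p k)‖ ≤ a := fun k => by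
    rcases min_le_iff.1 (hp k) with h | h
    · exact ⟨1, Or.inl rfl, by simpa using h⟩
    · exact ⟨-1, Or.inr rfl, by simpa using h⟩
  choose s hs using this
  exact ⟨p, s, fun k => (hs k).1, fun k => (hs k).2⟩

theorem atomDist_comm (u v : Vec d) : atomDist u v = atomDist v u := by
  unfold atomDist; rw [norm_sub_rev, add_comm]

theorem dist_le_of_mem_nearSet {Φ Ψ : Dict d K} {a : ℝ} (ha : 0 ≤ a) (h : Ψ ∈ nearSet Φ a) :
    dictDist Φ Ψ ≤ a ∧ dictDist Ψ Φ ≤ a ∧ symDist Φ Ψ ≤ a := by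
  obtain ⟨-, p, hp⟩ := h
  refine ⟨?_, ?_, ?_⟩
  · exact Real.iSup_le (fun k => (ciInf_le (Set.finite_range _).bddBelow (p k)).trans (hp k)) ha
  · refine Real.iSup_le (fun k => (ciInf_le (Set.finite_range _).bddBelow (p.symm k)).trans ?_) ha
    have := hp (p.symm k)
    rwa [Equiv.apply_symm_apply, atomDist_comm] at this
  · exact (ciInf_le (Set.finite_range _).bddBelow p).trans (Real.iSup_le hp ha)

/-- If the atoms of `Φ` are well separated, the asymmetric distance controls the symmetric one. -/
theorem mem_nearSet_of_dictDist_le {Φ Ψ : Dict d K} (hΦ : IsUnitNorm Φ) (hΨ : IsUnitNorm Ψ) {a : ℝ}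
    (hd : dictDist Φ Ψ ≤ a) (hcoh : coherence Φ < 1 - 2 * a ^ 2) : Ψ ∈ nearSet Φ a := by
  have h1 : ∀ k, ∃ l, atomDist (Φ k) (Ψ l) ≤ a := fun k => by
    have : Nonempty (Fin K) := ⟨k⟩
    obtain ⟨l, hl⟩ := exists_eq_ciInf_of_finite (f := fun l => atomDist (Φ k) (Ψ l))
    refine ⟨l, ?_⟩
    rw [hl]
    exact (le_ciSup (f := fun k => ⨅ l, atomDist (Φ k) (Ψ l))
      (Set.finite_range _).bddAbove k).trans hd
  choose σ hσ using h1
  -- Two atoms of Φ near the same ψ are within 2a of each other up to sign, so 2 - 2|⟨φ_k, φ_j⟩| ≤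
  -- 4a², against the coherence bound. Nearest atoms thus define a permutation.
  have hinj : Function.Injective σ := fun k j hkj => by
    by_contra hne
    have hc : |inner ℝ (Φ k) (Φ j)| ≤ coherence Φ :=
      le_ciSup (f := fun p : {p : Fin K × Fin K // p.1 ≠ p.2} => |inner ℝ (Φ p.1.1) (Φ p.1.2)|)
        (Set.finite_range _).bddAbove ⟨(k, j), hne⟩
    have hk := hσ k
    have hj := hσ j
    rw [← hkj] at hj
    have hs : ∀ k', atomDist (Φ k') (Ψ (σ k)) ≤ a → ∃ s : ℝ, |s| = 1 ∧ ‖Φ k' - s • Ψ (σ k)‖ ≤ a :=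
      fun k' h => by
        rcases min_le_iff.1 h with h | h
        · exact ⟨1, by simp, by simpa using h⟩
        · exact ⟨-1, by simp, by simpa using h⟩
    obtain ⟨s, hs1, hs2⟩ := hs k hk
    obtain ⟨t, ht1, ht2⟩ := hs j hj
    have hst : ‖Φ k - (s * t) • Φ j‖ ≤ 2 * a := by
      have htt : t * t = 1 := by rw [← abs_mul_abs_self, ht1, one_mul]
      have e : Φ k - (s * t) • Φ j = (Φ k - s • Ψ (σ k)) - (s * t) • (Φ j - t • Ψ (σ k)) := by
        rw [smul_sub, smul_smul, mul_assoc, htt, mul_one]; abel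
      rw [e]
      refine (norm_sub_le _ _).trans ?_
      rw [norm_smul, Real.norm_eq_abs, abs_mul, hs1, ht1, one_mul, one_mul]
      linarith
    have h2 := pow_le_pow_left₀ (norm_nonneg _) hst 2
    rw [norm_sub_sq_real, norm_smul, Real.norm_eq_abs, abs_mul, hs1, ht1, hΦ k, hΦ j,
      real_inner_smul_right] at h2
    have h3 : s * t * inner ℝ (Φ k) (Φ j) ≤ |inner ℝ (Φ k) (Φ j)| := by
      refine (le_abs_self _).trans ?_
      rw [abs_mul, abs_mul, hs1, ht1, one_mul, one_mul]
    linarith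
  exact ⟨hΨ, Equiv.ofBijective σ (Finite.injective_iff_bijective.1 hinj), hσ⟩

end Radius

/-! ### A single iteration contracts the distance with high probability. -/

section Iteration

variable {d K S N : ℕ}

theorem admissible {ν : Measure (Vec K)} {η : Measure (Vec d)} {β Δ : ℝ} (hS : 1 ≤ S)
    (hSK : S ≤ K) (hν : IsSparseLaw ν S β Δ) [IsProbabilityMeasure η] {Φ : Dict d K} {A B : ℝ}
    (hΦ : IsUnitNorm Φ) (hframe : IsFrame Φ A B) :
    Admissible K S B (noiseConst η) (gammaOne ν S) Δ where
  one_le_S := hS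
  S_le := hSK
  one_le_B := hframe.one_le hΦ ⟨0, by omega⟩
  C_pos := noiseConst_pos
  C_le := noiseConst_le_one
  γ_pos := hν.gammaOne_pos hS hSK
  γ_le := hν.gammaOne_le hS hSK
  Δ_pos := hν.gap_pos.trans hν.gap_lt
  Δ_le := hν.relGap_le_one hS hSK

theorem integral_norm_sub_integral_sq_le {Z : Type*} [MeasurableSpace Z] {π : Measure Z}
    [IsProbabilityMeasure π] {F : Z → Vec d} (hF : Integrable F π)
    (hF2 : Integrable (fun z => ‖F z‖ ^ 2) π) :
    ∫ z, ‖F z - ∫ z, F z ∂π‖ ^ 2 ∂π ≤ ∫ z, ‖F z‖ ^ 2 ∂π := by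
  set m := ∫ z, F z ∂π with hm
  have h1 : ∀ z, ‖F z - m‖ ^ 2 = ‖F z‖ ^ 2 - 2 * inner ℝ m (F z) + ‖m‖ ^ 2 := fun z => by
    rw [norm_sub_sq_real, real_inner_comm]
  have hi : Integrable (fun z => 2 * inner ℝ m (F z)) π := (hF.const_inner m).const_mul 2
  have hi2 : Integrable (fun z => ‖F z‖ ^ 2 - 2 * inner ℝ m (F z)) π := hF2.sub hi
  simp_rw [h1]
  rw [integral_add hi2 (integrable_const _), integral_sub hF2 hi, integral_const_mul,
    integral_inner hF, ← hm, real_inner_self_eq_norm_sq]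
  simp
  linarith [sq_nonneg ‖m‖]

/-- Concentration of the signed signal means around their expectation. -/
theorem measureReal_mean_signedSignal_le {ν : Measure (Vec K)} {η : Measure (Vec d)} {β Δ : ℝ}
    (hS : 1 ≤ S) (hSK : S ≤ K) (hν : IsSparseLaw ν S β Δ) [IsProbabilityMeasure η]
    {Φ : Dict d K} {A B : ℝ} (hΦ : IsUnitNorm Φ) (hframe : IsFrame Φ A B) {a : ℝ} (ha : 0 < a)
    (haR : a ≤ convRadius K B (noiseConst η) (gammaOne ν S) Δ)
    {Ω : Type*} [MeasurableSpace Ω] {P : Measure Ω} [IsProbabilityMeasure P]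
    {Z : Fin N → Ω → Vec K × Vec d} (hlaw : ∀ n, HasLaw (Z n) (ν.prod η) P)
    (hindep : iIndepFun Z P) (k : Fin K) :
    P.real {ω | N * (1 / 5 * a * (noiseConst η * gammaOne ν S / K)) ≤
      ‖∑ n, (signedSignal S Φ k (Z n ω) - (noiseConst η * gammaOne ν S / K) • Φ k)‖} ≤
      2 * Real.exp (-(noiseConst η ^ 2 * gammaOne ν S ^ 2 * N * a ^ 2) / (100 * S * K)) := by
  have := hν.isProbabilityMeasure
  have hadm : Admissible K S B (noiseConst η) (gammaOne ν S) Δ := admissible hS hSK hν hΦ hframe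
  set C := noiseConst η
  set γ := gammaOne ν S
  set m := (C * γ / K) • Φ k with hm
  have hC := hadm.C_pos
  have hγ := hadm.γ_pos
  have hB := hadm.one_le_B
  have hCγ := hadm.C_mul_γ_le
  have hS0 : (0 : ℝ) < S := by exact_mod_cast hS
  have hK1 := hadm.one_le_K
  have hK0 : (0 : ℝ) < K := by linarith
  have hSK' : (S : ℝ) ≤ K := by exact_mod_cast hSK
  have hFm := measurable_signedSignal S Φ k
  have hgap : ∀ᵐ z ∂(ν.prod η), HasGap S β Δ z.1 :=
    Measure.quasiMeasurePreserving_fst.ae (hν.ae_hasGap hS hSK)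
  have hFb : ∀ᵐ z ∂(ν.prod η), ‖signedSignal S Φ k z‖ ≤ √(B + 1) :=
    hgap.mono fun z hz => hframe.norm_signedSignal_le S k hz.norm_eq
  have hFi : Integrable (signedSignal S Φ k) (ν.prod η) :=
    Integrable.of_bound hFm.aestronglyMeasurable _ hFb
  have hF2 : Integrable (fun z => ‖signedSignal S Φ k z‖ ^ 2) (ν.prod η) := by
    refine Integrable.of_bound (hFm.norm.pow_const 2).aestronglyMeasurable (√(B + 1) ^ 2)
      (hFb.mono fun z hz => ?_)
    rw [Real.norm_of_nonneg (sq_nonneg _)]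
    exact pow_le_pow_left₀ (norm_nonneg _) hz 2
  have hmean : ∫ z, signedSignal S Φ k z ∂(ν.prod η) = m := integral_signedSignal hS hSK hν Φ k
  have hsq : 1 ≤ √(B + 1) := Real.one_le_sqrt.2 (by linarith)
  have hmn : ‖m‖ ≤ √(B + 1) := by
    rw [hm, norm_smul, hΦ k, mul_one, Real.norm_of_nonneg (by positivity)]
    have : C * γ / K ≤ 1 := (div_le_one hK0).2 (hCγ.trans hSK')
    linarith
  have hind : iIndepFun (fun n ω => signedSignal S Φ k (Z n ω) - m) P :=
    hindep.comp (fun _ z => signedSignal S Φ k z - m) fun _ => hFm.sub_const m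
  have hXm : Measurable fun z => signedSignal S Φ k z - m := hFm.sub_const m
  -- The parameter l = t/(2Ns) minimises the exponent -lt + N l² s, which becomes -N a² C² γ²/(100 S
  -- K).
  have h := measureReal_norm_sum_ge_le hind (fun n => hXm.comp_aemeasurable (hlaw n).aemeasurable)
    (M := 2 * √(B + 1)) (s := S / K) (l := a * (C * γ) / (10 * S))
    (t := N * (1 / 5 * a * (C * γ / K)))
    (fun n => by
      have h1 : ∀ᵐ z ∂(P.map (Z n)), ‖signedSignal S Φ k z‖ ≤ √(B + 1) := by
        rw [(hlaw n).map_eq]; exact hFb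
      filter_upwards [ae_of_ae_map (hlaw n).aemeasurable h1] with ω hω
      exact (norm_sub_le _ _).trans (by linarith))
    (fun n => by
      have := (hlaw n).integral_comp hXm.aestronglyMeasurable
      rw [integral_sub hFi (integrable_const _), hmean] at this
      simpa [Function.comp_def] using this)
    (fun n => by
      have h1 := (hlaw n).integral_comp (hXm.norm.pow_const 2).aestronglyMeasurable
      have h2 := integral_norm_sub_integral_sq_le hFi hF2
      rw [hmean] at h2
      simp only [Function.comp_def] at h1
      rw [h1]
      exact h2.trans (integral_norm_sq_signedSignal hS hSK hν hΦ k))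
    (by positivity) (by positivity) (by
      have h3 := (hadm.le_of_le_convRadius ha haR).2.2
      rw [div_mul_eq_mul_div, div_le_one (by positivity)]
      have h4 : C * γ * (a * √(B + 1)) ≤ S * (1 / 15) :=
        mul_le_mul hCγ h3 (by positivity) hS0.le
      nlinarith)
  refine h.trans (le_of_eq ?_)
  rw [Fintype.card_fin]
  congr 2
  field_simp
  ring

variable {ν : Measure (Vec K)} {η : Measure (Vec d)} {β Δ : ℝ}

/-- If few signals are bad and the signed signal means are close to their expectation, an
iteration brings the dictionary closer to the generating one. -/
theorem itksmStep_mem_nearSet {Φ Ψ : Dict d K} {A B : ℝ} (hΦ : IsUnitNorm Φ)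
    (hframe : IsFrame Φ A B) (hΨ : IsUnitNorm Ψ) {C γ : ℝ} (hadm : Admissible K S B C γ Δ)
    (hβ : 0 < β) {a : ℝ} (ha : 0 < a) (haR : a ≤ convRadius K B C γ Δ)
    {p : Equiv.Perm (Fin K)} {s : Fin K → ℝ} (hs : ∀ k, s k = 1 ∨ s k = -1)
    (hdist : ∀ k, ‖Φ k - realign Ψ p s k‖ ≤ a)
    {sel : Dict d K → Vec d → Finset (Fin K)} (hsel : IsThresholding S sel) (hN : 0 < N)
    {z : Fin N → Vec K × Vec d} (hz : ∀ n, HasGap S β Δ (z n).1)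
    (hcount : ∑ n, (badSet Φ (realign Ψ p s) β Δ).indicator (fun _ => (1 : ℝ)) (z n) ≤
      N * (3 / 10 * (a * (C * γ) / (K * √(B + 1)))))
    (hmean : ∀ k, ‖∑ n, (signedSignal S Φ k (z n) - (C * γ / K) • Φ k)‖ ≤
      N * (1 / 5 * a * (C * γ / K))) :
    itksmStep sel (fun n => signal Φ (z n).1 (z n).2) Ψ ∈ nearSet Φ (83 / 100 * a) := by
  have hC := hadm.C_pos
  have hγ := hadm.γ_pos
  have hB := hadm.one_le_B
  have hK0 : (0 : ℝ) < K := by linarith [hadm.one_le_K]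
  have hsq : 0 < √(B + 1) := Real.sqrt_pos.2 (by linarith)
  have hN0 : (0 : ℝ) < N := by exact_mod_cast hN
  obtain ⟨ha1, ha2, -⟩ := hadm.le_of_le_convRadius ha haR
  set G := badSet Φ (realign Ψ p s) β Δ
  set y : Fin N → Vec d := fun n => signal Φ (z n).1 (z n).2 with hy
  -- Good signals contribute exactly their ideal summand; a bad one costs at most twice the norm
  -- bound.
  have hdiff : ∀ k n, ‖s k • contribution sel Ψ (y n) (p k) - signedSignal S Φ k (z n)‖ ≤
      2 * √(B + 1) * G.indicator (fun _ => (1 : ℝ)) (z n) := fun k n => by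
    by_cases hbad : z n ∈ G
    · rw [Set.indicator_of_mem hbad, mul_one]
      have h1 := hframe.norm_signedSignal_le S k (hz n).norm_eq
      have h2 := (norm_contribution_le sel Ψ (y n) (p k)).trans
        (hframe.norm_signal_le (hz n).norm_eq (z n).2)
      refine (norm_sub_le _ _).trans ?_
      rw [norm_smul, Real.norm_eq_abs, abs_eq_one_of_sign (hs k)]
      linarith
    · rw [contribution_eq_signedSignal hΦ hΨ hs hsel hβ hadm.Δ_pos hadm.Δ_le ha2 hdist (hz n) hbad k,
        sub_self, norm_zero, Set.indicator_of_notMem hbad, mul_zero]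
  have hclose : ∀ k, ‖s k • signalMean sel y Ψ (p k) - (C * γ / K) • Φ k‖ ≤
      C * γ / K * (4 / 5 * a) := fun k => by
    have e : s k • signalMean sel y Ψ (p k) - (C * γ / K) • Φ k = (N : ℝ)⁻¹ •
        (∑ n, (s k • contribution sel Ψ (y n) (p k) - signedSignal S Φ k (z n)) +
          ∑ n, (signedSignal S Φ k (z n) - (C * γ / K) • Φ k)) := by
      rw [← Finset.sum_add_distrib]
      simp_rw [sub_add_sub_cancel]
      rw [Finset.sum_sub_distrib, ← Finset.smul_sum, smul_sub, Finset.sum_const, Finset.card_univ,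
        Fintype.card_fin, ← Nat.cast_smul_eq_nsmul ℝ, inv_smul_smul₀ hN0.ne', smul_comm]
      rfl
    rw [e, norm_smul, norm_inv, Real.norm_of_nonneg hN0.le, inv_mul_le_iff₀ hN0]
    refine (norm_add_le _ _).trans ?_
    have h1 : ‖∑ n, (s k • contribution sel Ψ (y n) (p k) - signedSignal S Φ k (z n))‖ ≤
        2 * √(B + 1) * (N * (3 / 10 * (a * (C * γ) / (K * √(B + 1))))) := by
      refine (norm_sum_le_of_le _ fun n _ => hdiff k n).trans ?_
      rw [← Finset.mul_sum]
      exact mul_le_mul_of_nonneg_left hcount (by positivity)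
    -- Bad signals account for 3/5 and the fluctuation for 1/5 of a, together 4/5.
    have h2 : 2 * √(B + 1) * (N * (3 / 10 * (a * (C * γ) / (K * √(B + 1))))) =
        N * (3 / 5 * a * (C * γ / K)) := by
      field_simp
      ring
    rw [h2] at h1
    linarith [hmean k]
  have hstep : ∀ k, 0 < ‖signalMean sel y Ψ (p k)‖ ∧
      ‖s k • itksmStep sel y Ψ (p k) - Φ k‖ ≤ 83 / 100 * a := fun k => by
    have hsn : ‖s k • signalMean sel y Ψ (p k)‖ = ‖signalMean sel y Ψ (p k)‖ := by
      rw [norm_smul, Real.norm_eq_abs, abs_eq_one_of_sign (hs k), one_mul]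
    obtain ⟨h1, h2⟩ := norm_normalize_sub_le (hΦ k) (by positivity : 0 < C * γ / K)
      (by linarith : 4 / 5 * a < 1) (hclose k)
    rw [hsn] at h1 h2
    refine ⟨h1, (abs_le_of_sq_le_sq' ?_ (by positivity)).2⟩
    have e : s k • itksmStep sel y Ψ (p k) =
        ‖signalMean sel y Ψ (p k)‖⁻¹ • s k • signalMean sel y Ψ (p k) := by
      rw [itksmStep, smul_comm]
    rw [e]
    refine h2.trans ?_
    rw [div_le_iff₀ (by linarith)]
    -- With a ≤ 9/200, 0.64/(1 - 0.8a) is below 0.83² = 0.6889.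
    nlinarith [sq_nonneg a]
  refine ⟨fun l => ?_, p, fun k => ?_⟩
  · obtain ⟨k, rfl⟩ := p.surjective l
    have h1 := (hstep k).1
    rw [itksmStep, norm_smul, norm_inv, norm_norm, inv_mul_cancel₀ h1.ne']
  · have h2 := (hstep k).2
    rw [norm_sub_rev] at h2
    unfold atomDist
    rcases hs k with h | h
    · rw [h, one_smul] at h2
      exact (min_le_left _ _).trans h2
    · rw [h, neg_one_smul, sub_neg_eq_add] at h2
      exact (min_le_right _ _).trans h2

/-- One iteration reduces the distance to the generating dictionary with high probability. -/
theorem measureReal_itksmStep_notMem_le (hS : 1 ≤ S) (hSK : S ≤ K) {Φ : Dict d K} {A B : ℝ}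
    (hΦ : IsUnitNorm Φ) (hframe : IsFrame Φ A B) (hν : IsSparseLaw ν S β Δ)
    {ρ : ℝ≥0} (hη : IsSubgaussianNoise η ρ) {ε a : ℝ} (hε0 : 0 < ε)
    (hεmin : 4 * minError K B (noiseConst η) (gammaOne ν S) β (coherence Φ) ρ ≤ ε)
    (hεa : ε ≤ a) (haR : a ≤ convRadius K B (noiseConst η) (gammaOne ν S) Δ)
    {Ψ : Dict d K} (hΨ : Ψ ∈ nearSet Φ a)
    {sel : Dict d K → Vec d → Finset (Fin K)} (hsel : IsThresholding S sel) (hN : 0 < N)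
    {Ω : Type*} [MeasurableSpace Ω] {P : Measure Ω} [IsProbabilityMeasure P]
    {Z : Fin N → Ω → Vec K × Vec d} (hlaw : ∀ n, HasLaw (Z n) (ν.prod η) P)
    (hindep : iIndepFun Z P) :
    P.real {ω | itksmStep sel (fun n => signal Φ (Z n ω).1 (Z n ω).2) Ψ ∉
      nearSet Φ (83 / 100 * a)} ≤
      3 * K * Real.exp (-(noiseConst η ^ 2 * gammaOne ν S ^ 2 * N * ε ^ 2) / (200 * S * K)) := by
  have := hν.isProbabilityMeasure
  have := hη.isProbabilityMeasure
  have ha : 0 < a := hε0.trans_le hεa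
  have hadm : Admissible K S B (noiseConst η) (gammaOne ν S) Δ := admissible hS hSK hν hΦ hframe
  have hconc := measureReal_mean_signedSignal_le hS hSK hν hΦ hframe ha haR hlaw hindep
  have hC := hadm.C_pos
  have hγ := hadm.γ_pos
  have hB := hadm.one_le_B
  have hCγ := hadm.C_mul_γ_le
  have hK1 := hadm.one_le_K
  have hK0 : (0 : ℝ) < K := by linarith
  have hS0 : (0 : ℝ) < S := by exact_mod_cast hS
  have hsq : 0 < √(B + 1) := Real.sqrt_pos.2 (by linarith)
  have hpert := hadm.perturbation_le ha haR
  have hrad := hadm.le_of_le_convRadius ha haR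
  obtain ⟨p, s, hs, hdist⟩ := exists_realign_of_mem_nearSet hΨ
  have hΨ1 : IsUnitNorm Ψ := hΨ.1
  have hbad := measureReal_badSet_le hS hSK hν hη hframe hΦ (isUnitNorm_realign hΨ1 p hs) ha hdist
  have hdet := fun {z : Fin N → Vec K × Vec d} => itksmStep_mem_nearSet (z := z) hΦ hframe hΨ1 hadm
    hν.gap_pos ha haR hs hdist hsel hN
  rw [minError] at hεmin
  set C := noiseConst η
  set γ := gammaOne ν S
  set E1 := (if max (coherence Φ ^ 2) ((ρ : ℝ) ^ 2) = 0 then 0 else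
    Real.exp (-β ^ 2 / (98 * max (coherence Φ ^ 2) ((ρ : ℝ) ^ 2))))
  set E2 := Real.exp (-Δ ^ 2 / (98 * (B * a ^ 2)))
  set G := badSet Φ (realign Ψ p s) β Δ
  have hG : MeasurableSet G := measurableSet_badSet _ _ _ _
  set τ := a * (C * γ) / (K * √(B + 1)) with hτ
  -- In units of τ, the coherence and noise part contributes 1/8 by 4ε_{μ,ρ} ≤ ε ≤ a, the
  -- perturbation part 1/25; their sum is 33/200.
  have hq : K * (4 * E1 + 2 * E2) ≤ 33 / 200 * τ := by
    have h1 : 4 * (8 * (K : ℝ) ^ 2 * √(B + 1) * E1) ≤ ε * (C * γ) := by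
      rw [div_mul_eq_mul_div, ← mul_div_assoc, div_le_iff₀ (by positivity)] at hεmin
      exact hεmin
    have h2 : ε * (C * γ) ≤ a * (C * γ) := by gcongr
    rw [hτ, ← mul_div_assoc, le_div_iff₀ (by positivity)]
    nlinarith
  set E := Real.exp (-(C ^ 2 * γ ^ 2 * N * ε ^ 2) / (200 * S * K)) with hE
  have hεa2 : ε ^ 2 ≤ a ^ 2 := pow_le_pow_left₀ hε0.le hεa 2
  have hcount : P.real {ω | N * (3 / 10 * τ) ≤ ∑ n, G.indicator (fun _ => (1 : ℝ)) (Z n ω)} ≤ E := by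
    refine (measureReal_count_ge_le hindep (fun n => (hlaw n).aemeasurable) hG
      (q := 33 / 200 * τ) fun n => ?_).trans (Real.exp_le_exp.2 ?_)
    · rw [(hlaw n).measureReal_eq (p := fun z => z ∈ G) hG]
      exact hbad.trans hq
    -- The Chernoff exponent has a margin because 43/25 · 33/200 = 0.2838 < 3/10. What is left
    -- exceeds 1/3000, which is all that a √(B+1) ≤ 1/15 requires.
    · rw [Fintype.card_fin, neg_div]
      have h1 : C ^ 2 * γ ^ 2 * N * ε ^ 2 / (200 * S * K) ≤ N * (1 / 3000 * τ) := by
        rw [div_le_iff₀ (by positivity), hτ]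
        have e : N * (1 / 3000 * (a * (C * γ) / (K * √(B + 1)))) * (200 * S * K) =
            (N * a * (C * γ)) * (1 / 15 * S / √(B + 1)) := by
          field_simp
          ring
        rw [e]
        have h3 : C * γ * a ≤ 1 / 15 * S / √(B + 1) := by
          rw [le_div_iff₀ hsq]
          have := mul_le_mul hCγ hrad.2.2 (by positivity) hS0.le
          linarith
        calc C ^ 2 * γ ^ 2 * N * ε ^ 2 ≤ C ^ 2 * γ ^ 2 * N * a ^ 2 := by gcongr
          _ = (N * a * (C * γ)) * (C * γ * a) := by ring
          _ ≤ _ := mul_le_mul_of_nonneg_left h3 (by positivity)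
      have h2 : 0 ≤ N * τ := by positivity
      linarith
  have hmean : ∀ k, P.real {ω | N * (1 / 5 * a * (C * γ / K)) ≤
      ‖∑ n, (signedSignal S Φ k (Z n ω) - (C * γ / K) • Φ k)‖} ≤ 2 * E := fun k => by
    refine (hconc k).trans ?_
    refine mul_le_mul_of_nonneg_left (Real.exp_le_exp.2 ?_) zero_le_two
    rw [neg_div, neg_div, neg_le_neg_iff]
    calc C ^ 2 * γ ^ 2 * N * ε ^ 2 / (200 * S * K) ≤ C ^ 2 * γ ^ 2 * N * a ^ 2 / (200 * S * K) := by
          gcongr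
      _ ≤ C ^ 2 * γ ^ 2 * N * a ^ 2 / (100 * S * K) := by gcongr; norm_num
  have hgap : ∀ᵐ ω ∂P, ∀ n, HasGap S β Δ (Z n ω).1 := by
    refine ae_all_iff.2 fun n => ?_
    have h1 : ∀ᵐ z ∂(P.map (Z n)), HasGap S β Δ z.1 := by
      rw [(hlaw n).map_eq]
      exact Measure.quasiMeasurePreserving_fst.ae (hν.ae_hasGap hS hSK)
    exact ae_of_ae_map (hlaw n).aemeasurable h1
  have hsub : {ω | itksmStep sel (fun n => signal Φ (Z n ω).1 (Z n ω).2) Ψ ∉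
      nearSet Φ (83 / 100 * a)} ≤ᵐ[P]
      ({ω | N * (3 / 10 * τ) ≤ ∑ n, G.indicator (fun _ => (1 : ℝ)) (Z n ω)} ∪
      ⋃ k, {ω | N * (1 / 5 * a * (C * γ / K)) ≤
        ‖∑ n, (signedSignal S Φ k (Z n ω) - (C * γ / K) • Φ k)‖} : Set Ω) := by
    filter_upwards [hgap] with ω hω hmem
    by_contra hcon
    have hcon' : ω ∉ ({ω | N * (3 / 10 * τ) ≤ ∑ n, G.indicator (fun _ => (1 : ℝ)) (Z n ω)} ∪
      ⋃ k, {ω | N * (1 / 5 * a * (C * γ / K)) ≤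
        ‖∑ n, (signedSignal S Φ k (Z n ω) - (C * γ / K) • Φ k)‖} : Set Ω) := hcon
    rw [Set.mem_union, not_or, Set.mem_iUnion, not_exists] at hcon'
    exact hmem (hdet (z := fun n => Z n ω) hω (not_le.1 hcon'.1).le
      fun k => (not_le.1 (hcon'.2 k)).le)
  have h1 := ENNReal.toReal_mono (measure_ne_top _ _) (measure_mono_ae hsub)
  refine (h1.trans (measureReal_union_le _ _)).trans ?_
  have h2 := (measureReal_iUnion_fintype_le (μ := P) fun k : Fin K =>
    {ω | N * (1 / 5 * a * (C * γ / K)) ≤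
        ‖∑ n, (signedSignal S Φ k (Z n ω) - (C * γ / K) • Φ k)‖}).trans
    (Finset.sum_le_sum fun k _ => hmean k)
  rw [Finset.sum_const, Finset.card_univ, Fintype.card_fin, nsmul_eq_mul] at h2
  have hEpos : 0 < E := Real.exp_pos _
  -- One count event and K mean events give E + 2KE ≤ 3KE.
  nlinarith

end Iteration

/-! ### Chaining the iterations over independent batches. -/

section Induction

variable {d K S N : ℕ}

/-- Joint measurability in dictionary and batch is what permits conditioning on the current iterate.
-/
theorem measurable_itksmStep {sel : Dict d K → Vec d → Finset (Fin K)}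
    (hsel : IsThresholding S sel) :
    Measurable fun q : Dict d K × (Fin N → Vec d) => itksmStep sel q.2 q.1 := by
  have hmem : ∀ k, MeasurableSet {q : Dict d K × Vec d | k ∈ sel q.1 q.2} := fun k => by
    have : {q : Dict d K × Vec d | k ∈ sel q.1 q.2} =
        ⋃ I ∈ {I : Finset (Fin K) | k ∈ I}, {q | sel q.1 q.2 = I} := by ext; simp
    rw [this]
    exact MeasurableSet.biUnion (Set.to_countable _) fun I _ => hsel.measurable I
  have hmean : ∀ k, Measurable fun q : Dict d K × (Fin N → Vec d) =>
      signalMean sel q.2 q.1 k := fun k => by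
    unfold signalMean
    have hsum : Measurable fun q : Dict d K × (Fin N → Vec d) =>
        ∑ n, if k ∈ sel q.1 (q.2 n) then Real.sign (inner ℝ (q.1 k) (q.2 n)) • q.2 n else 0 := ?_
    · exact hsum.const_smul (N : ℝ)⁻¹
    refine Finset.measurable_fun_sum _ fun n _ => ?_
    have hpair : Measurable fun q : Dict d K × (Fin N → Vec d) => (q.1, q.2 n) := by fun_prop
    refine Measurable.ite (hpair (hmem k)) ?_ measurable_const
    have hin : Measurable fun q : Dict d K × (Fin N → Vec d) => inner ℝ (q.1 k) (q.2 n) :=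
      Measurable.inner (by fun_prop) (by fun_prop)
    exact (measurable_sign.comp hin).smul (by fun_prop)
  refine measurable_pi_lambda _ fun k => ?_
  exact ((hmean k).norm.inv).smul (hmean k)

theorem measurable_itksm {sel : Dict d K → Vec d → Finset (Fin K)} (hsel : IsThresholding S sel)
    (Ψ : Dict d K) (L : ℕ) :
    Measurable fun Y : Fin L → Fin N → Vec d => itksm sel L Y Ψ := by
  induction L with
  | zero => exact measurable_const
  | succ L ih =>
    have h0 : Measurable fun (Y : Fin (L + 1) → Fin N → Vec d) (i : Fin L) => Y i.castSucc :=
      measurable_pi_lambda _ fun i => measurable_pi_apply _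
    have h1 : Measurable fun Y : Fin (L + 1) → Fin N → Vec d => Y (Fin.last L) :=
      measurable_pi_apply _
    have h2 : Measurable fun Y : Fin (L + 1) → Fin N → Vec d =>
        (itksm sel L (fun i => Y i.castSucc) Ψ, Y (Fin.last L)) := (ih.comp h0).prodMk h1
    have h3 := (measurable_itksmStep (N := N) hsel).comp h2
    simpa only [itksm, Function.comp_def] using h3

/-- A bound for the failure probability of an event depending on two independent variables, by
conditioning on the first one. -/
theorem IndepFun.measure_pair_mem_le {Ω α γ : Type*} [MeasurableSpace Ω] [MeasurableSpace α]
    [MeasurableSpace γ] {P : Measure Ω} [IsProbabilityMeasure P] {W : Ω → α} {Y : Ω → γ}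
    (hWY : IndepFun W Y P) (hW : AEMeasurable W P) (hY : AEMeasurable Y P) {G : Set α}
    (hG : MeasurableSet G) {D : Set (α × γ)} (hD : MeasurableSet D) {q : ℝ≥0∞}
    (h : ∀ w ∈ G, P {ω | (w, Y ω) ∈ D} ≤ q) :
    P {ω | (W ω, Y ω) ∈ D} ≤ P {ω | W ω ∉ G} + q := by
  have := Measure.isProbabilityMeasure_map (μ := P) hW
  have := Measure.isProbabilityMeasure_map (μ := P) hY
  have hsub : {ω | (W ω, Y ω) ∈ D} ⊆ {ω | W ω ∉ G} ∪
      {ω | (W ω, Y ω) ∈ D ∩ Prod.fst ⁻¹' G} := fun ω hω => by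
    by_cases hg : W ω ∈ G
    · exact Or.inr ⟨hω, hg⟩
    · exact Or.inl hg
  refine (measure_mono hsub).trans ((measure_union_le _ _).trans ?_)
  gcongr
  have hDG : MeasurableSet (D ∩ Prod.fst ⁻¹' G) := hD.inter (measurable_fst hG)
  have e : P {ω | (W ω, Y ω) ∈ D ∩ Prod.fst ⁻¹' G} =
      ((P.map W).prod (P.map Y)) (D ∩ Prod.fst ⁻¹' G) := by
    rw [← (indepFun_iff_map_prod_eq_prod_map_map hW hY).1 hWY,
      Measure.map_apply_of_aemeasurable (hW.prodMk hY) hDG]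
    rfl
  rw [e, Measure.prod_apply hDG]
  calc ∫⁻ w, (P.map Y) (Prod.mk w ⁻¹' (D ∩ Prod.fst ⁻¹' G)) ∂(P.map W)
      ≤ ∫⁻ _, q ∂(P.map W) := by
        refine lintegral_mono fun w => ?_
        rw [Measure.map_apply_of_aemeasurable hY (measurable_prodMk_left hDG)]
        by_cases hw : w ∈ G
        · refine le_trans (measure_mono fun ω hω => ?_) (h w hw)
          exact hω.1
        · have : Y ⁻¹' (Prod.mk w ⁻¹' (D ∩ Prod.fst ⁻¹' G)) = ∅ := by
            ext ω; simp [hw]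
          rw [this, measure_empty]; exact zero_le
    _ = q := by simp

variable {ν : Measure (Vec K)} {η : Measure (Vec d)} {β Δ : ℝ}

/-- Induction on the number of batches used: the radius shrinks by 83/100 until it saturates at ε.
As it never drops below ε, every step fails with probability at most the same bound, stated with ε,
and the failures add up. -/
theorem measure_itksm_notMem_le (hS : 1 ≤ S) (hSK : S ≤ K) {Φ : Dict d K} {A B : ℝ}
    (hΦ : IsUnitNorm Φ) (hframe : IsFrame Φ A B) (hν : IsSparseLaw ν S β Δ)
    {ρ : ℝ≥0} (hη : IsSubgaussianNoise η ρ) {ε R : ℝ} (hε0 : 0 < ε)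
    (hεmin : 4 * minError K B (noiseConst η) (gammaOne ν S) β (coherence Φ) ρ ≤ ε)
    (hεR : ε ≤ R) (hR : R ≤ convRadius K B (noiseConst η) (gammaOne ν S) Δ)
    {Ψ : Dict d K} (hΨ : Ψ ∈ nearSet Φ R)
    {sel : Dict d K → Vec d → Finset (Fin K)} (hsel : IsThresholding S sel) (hN : 0 < N)
    {L : ℕ} {Ω : Type*} [MeasurableSpace Ω] {P : Measure Ω} [IsProbabilityMeasure P]
    {Z : Fin L → Fin N → Ω → Vec K × Vec d} (hlaw : ∀ i n, HasLaw (Z i n) (ν.prod η) P)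
    (hindep : iIndepFun (fun p : Fin L × Fin N => Z p.1 p.2) P) (i : ℕ) (hi : i ≤ L) :
    P {ω | itksm sel i (fun j n => signal Φ (Z (j.castLE hi) n ω).1 (Z (j.castLE hi) n ω).2) Ψ ∉
      nearSet Φ (max ε ((83 / 100) ^ i * R))} ≤
      i * ENNReal.ofReal (3 * K * Real.exp
        (-(noiseConst η ^ 2 * gammaOne ν S ^ 2 * N * ε ^ 2) / (200 * S * K))) := by
  have := hη.isProbabilityMeasure
  induction i with
  | zero =>
    have h0 : ∀ ω, itksm sel 0 (fun j n => signal Φ (Z (j.castLE hi) n ω).1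
        (Z (j.castLE hi) n ω).2) Ψ ∈ nearSet Φ (max ε ((83 / 100) ^ 0 * R)) := fun ω =>
      nearSet_mono (by simp) hΨ
    refine (measure_mono_null (fun ω hω => absurd (h0 ω) hω) measure_empty).trans_le zero_le
  | succ i ih =>
    have hi' : i ≤ L := by omega
    have hR0 : 0 < R := hε0.trans_le hεR
    set a := max ε ((83 / 100) ^ i * R) with ha
    have haR : a ≤ R := max_le hεR (mul_le_of_le_one_left hR0.le
      (pow_le_one₀ (by norm_num) (by norm_num)))
    have hab : 83 / 100 * a ≤ max ε ((83 / 100) ^ (i + 1) * R) := by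
      rw [ha, mul_max_of_nonneg _ _ (by norm_num : (0 : ℝ) ≤ 83 / 100)]
      refine max_le_max (by linarith) (le_of_eq (by ring))
    have hsm := measurable_signal Φ
    let l : Fin L := ⟨i, hi⟩
    -- Samples of the earlier batches, which determine the current iterate, are separated from those
    -- of batch i, so that iterate and new batch are independent.
    let T1 : Finset (Fin L × Fin N) := Finset.univ.filter fun p => p.1 < l
    let T2 : Finset (Fin L × Fin N) := Finset.univ.filter fun p => p.1 = l
    have hdisj : Disjoint T1 T2 := by
      rw [Finset.disjoint_left]
      intro p h1 h2
      simp only [T1, T2, Finset.mem_filter, Finset.mem_univ, true_and] at h1 h2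
      exact absurd h2 h1.ne
    have hind := hindep.indepFun_finset₀ T1 T2 hdisj fun p => (hlaw p.1 p.2).aemeasurable
    let φ : (T1 → Vec K × Vec d) → Dict d K := fun f => itksm sel i (fun j n =>
      signal Φ (f ⟨(j.castLE hi', n), by
        simp only [T1, l, Finset.mem_filter, Finset.mem_univ, true_and]
        exact Fin.lt_def.2 j.2⟩).1
        (f ⟨(j.castLE hi', n), by
        simp only [T1, l, Finset.mem_filter, Finset.mem_univ, true_and]
        exact Fin.lt_def.2 j.2⟩).2) Ψ
    let ψ : (T2 → Vec K × Vec d) → Fin N → Vec d := fun f n =>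
      signal Φ (f ⟨(l, n), by simp [T2]⟩).1 (f ⟨(l, n), by simp [T2]⟩).2
    have hφ : Measurable φ := (measurable_itksm hsel Ψ i).comp <|
      measurable_pi_lambda _ fun j => measurable_pi_lambda _ fun n =>
        hsm.comp (measurable_pi_apply _)
    have hψ : Measurable ψ := measurable_pi_lambda _ fun n => hsm.comp (measurable_pi_apply _)
    have hm1 : AEMeasurable (fun ω (p : T1) => Z p.1.1 p.1.2 ω) P :=
      aemeasurable_pi_lambda _ fun p => (hlaw p.1.1 p.1.2).aemeasurable
    have hm2 : AEMeasurable (fun ω (p : T2) => Z p.1.1 p.1.2 ω) P :=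
      aemeasurable_pi_lambda _ fun p => (hlaw p.1.1 p.1.2).aemeasurable
    have hWY := hind.comp hφ hψ
    have hW := hφ.comp_aemeasurable hm1
    have hY := hψ.comp_aemeasurable hm2
    have hD : MeasurableSet {q : Dict d K × (Fin N → Vec d) |
        itksmStep sel q.2 q.1 ∉ nearSet Φ (max ε ((83 / 100) ^ (i + 1) * R))} :=
      measurable_itksmStep hsel (measurableSet_nearSet Φ _).compl
    have hpre : iIndepFun (fun n => Z l n) P :=
      hindep.precomp (g := fun n : Fin N => (l, n)) fun n n' h => (Prod.mk.inj h).2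
    have hstep := IndepFun.measure_pair_mem_le hWY hW hY (measurableSet_nearSet Φ a) hD
      (q := ENNReal.ofReal (3 * K * Real.exp
        (-(noiseConst η ^ 2 * gammaOne ν S ^ 2 * N * ε ^ 2) / (200 * S * K)))) fun w hw => by
        have h1 := measureReal_itksmStep_notMem_le hS hSK hΦ hframe hν hη hε0 hεmin
          (le_max_left _ _) (haR.trans hR) hw hsel hN (hlaw l) hpre
        refine le_trans (measure_mono fun ω hω => ?_)
          ((ENNReal.le_ofReal_iff_toReal_le (measure_ne_top _ _) (by positivity)).2 h1)
        exact fun hmem => hω (nearSet_mono hab hmem)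
    have hsucc : ((i + 1 : ℕ) : ℝ≥0∞) * ENNReal.ofReal (3 * K * Real.exp
        (-(noiseConst η ^ 2 * gammaOne ν S ^ 2 * N * ε ^ 2) / (200 * S * K))) =
        i * ENNReal.ofReal (3 * K * Real.exp
        (-(noiseConst η ^ 2 * gammaOne ν S ^ 2 * N * ε ^ 2) / (200 * S * K))) +
        ENNReal.ofReal (3 * K * Real.exp
        (-(noiseConst η ^ 2 * gammaOne ν S ^ 2 * N * ε ^ 2) / (200 * S * K))) := by
      push_cast; ring
    rw [hsucc]
    exact hstep.trans (add_le_add_left (ih hi') _)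

/-- A dictionary satisfying the constraint on the minimal error has small coherence. -/
theorem Admissible.coherence_lt {B C γ : ℝ} (hadm : Admissible K S B C γ Δ) (hβ : 0 < β)
    (hβΔ : β < Δ) {μ ρ R : ℝ} (hmin : 4 * minError K B C γ β μ ρ ≤ R) (hR : 0 < R)
    (hRR : R ≤ convRadius K B C γ Δ) : μ < 1 - 2 * R ^ 2 := by
  by_contra hcon
  have hR1 := (hadm.le_of_le_convRadius hR hRR).1
  -- With so large a coherence the exponential in the minimal error is at least 1/2 and its
  -- prefactor at least 8, so four times it cannot be below R ≤ 9/200.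
  have hμ : 9 / 10 ≤ μ := by nlinarith [not_lt.1 hcon]
  have hm : 81 / 100 ≤ max (μ ^ 2) (ρ ^ 2) := le_max_of_le_left (by nlinarith)
  rw [minError, if_neg (by linarith)] at hmin
  set m := max (μ ^ 2) (ρ ^ 2)
  have hβ1 : β ^ 2 ≤ 1 := pow_le_one₀ hβ.le (hβΔ.le.trans hadm.Δ_le)
  have h1 : 1 / 2 ≤ Real.exp (-β ^ 2 / (98 * m)) := by
    refine le_trans ?_ (Real.add_one_le_exp _)
    have : β ^ 2 / (98 * m) ≤ 1 / 2 := by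
      rw [div_le_iff₀ (by positivity)]; linarith
    rw [neg_div]; linarith
  have hC := hadm.C_pos
  have hγ := hadm.γ_pos
  have hK := hadm.one_le_K
  have h2 : 1 ≤ √(B + 1) := Real.one_le_sqrt.2 (by linarith [hadm.one_le_B])
  have h3 : 8 ≤ 8 * (K : ℝ) ^ 2 * √(B + 1) / (C * γ) := by
    rw [le_div_iff₀ (by positivity)]
    have h4 : C * γ ≤ K := hadm.C_mul_γ_le.trans (by exact_mod_cast hadm.S_le)
    nlinarith
  nlinarith

end Induction

end DictLearn

open DictLearn

/-! ### The main theorem. -/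

theorem theorem1 {d K S N : ℕ} (hS : 1 ≤ S) (hSK : S ≤ K)
    -- the generating dictionary
    (Φ : Dict d K) (A B : ℝ) (hΦ : IsUnitNorm Φ) (hframe : IsFrame Φ A B)
    -- the coefficient law and the noise law
    (ν : Measure (Vec K)) (β Δ : ℝ) (hν : IsSparseLaw ν S β Δ)
    (η : Measure (Vec d)) (ρ : ℝ≥0) (hη : IsSubgaussianNoise η ρ)
    -- the target error
    (ε : ℝ) (hε0 : 0 < ε)
    (hεmin : 4 * minError K B (noiseConst η) (gammaOne ν S) β (coherence Φ) ρ ≤ ε)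
    (hεmax : ε ≤ convRadius K B (noiseConst η) (gammaOne ν S) Δ)
    -- the input dictionary
    (Ψ : Dict d K) (hΨ : IsUnitNorm Ψ)
    (hdist : dictDist Φ Ψ ≤ convRadius K B (noiseConst η) (gammaOne ν S) Δ)
    -- the thresholding rule
    (sel : Dict d K → Vec d → Finset (Fin K)) (hsel : IsThresholding S sel)
    -- the number of iterations
    (L : ℕ) (hL : L = 6 * ⌈Real.log ε⁻¹⌉₊)
    -- independent coefficients and noise vectors for `L` batches of `N` signals
    {Ω : Type*} [MeasurableSpace Ω] (P : Measure Ω) [IsProbabilityMeasure P]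
    (x : Fin L → Fin N → Ω → Vec K) (r : Fin L → Fin N → Ω → Vec d)
    (hlaw : ∀ i n, HasLaw (fun ω => (x i n ω, r i n ω)) (ν.prod η) P)
    (hindep : iIndepFun (fun (p : Fin L × Fin N) ω => (x p.1 p.2 ω, r p.1 p.2 ω)) P) :
    P {ω | ¬ (dictDist Φ (itksm sel L (fun i n => signal Φ (x i n ω) (r i n ω)) Ψ) ≤ ε ∧
        dictDist (itksm sel L (fun i n => signal Φ (x i n ω) (r i n ω)) Ψ) Φ ≤ ε ∧
        symDist Φ (itksm sel L (fun i n => signal Φ (x i n ω) (r i n ω)) Ψ) ≤ ε)} ≤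
      ENNReal.ofReal (18 * (⌈Real.log ε⁻¹⌉₊ : ℝ) * K *
        Real.exp (-(noiseConst η ^ 2 * gammaOne ν S ^ 2 * N * ε ^ 2) / (200 * S * K))) := by
  have := hη.isProbabilityMeasure
  have hadm : Admissible K S B (noiseConst η) (gammaOne ν S) Δ := admissible hS hSK hν hΦ hframe
  have hε1 := (hadm.le_of_le_convRadius hε0 hεmax).1
  have hRpos := hadm.convRadius_pos
  have hR1 := (hadm.le_of_le_convRadius hRpos le_rfl).1
  have hlog : 0 < Real.log ε⁻¹ := Real.log_pos (by
    rw [one_lt_inv₀ hε0]; linarith)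
  have hceil : 0 < ⌈Real.log ε⁻¹⌉₊ := Nat.ceil_pos.2 hlog
  -- Without signals the exponential is 1 and the claimed probability bound is at least 1.
  rcases Nat.eq_zero_or_pos N with hN | hN
  · refine prob_le_one.trans ?_
    rw [ENNReal.one_le_ofReal, hN]
    have h1 : (1 : ℝ) ≤ ⌈Real.log ε⁻¹⌉₊ := by exact_mod_cast hceil
    have h2 := hadm.one_le_K
    simp only [CharP.cast_eq_zero, mul_zero, zero_mul, neg_zero, zero_div, Real.exp_zero, mul_one]
    nlinarith
  have hnear : Ψ ∈ nearSet Φ (convRadius K B (noiseConst η) (gammaOne ν S) Δ) :=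
    mem_nearSet_of_dictDist_le hΦ hΨ hdist
      (hadm.coherence_lt hν.gap_pos hν.gap_lt (hεmin.trans hεmax) hRpos le_rfl)
  have hfinal := measure_itksm_notMem_le hS hSK hΦ hframe hν hη hε0 hεmin hεmax le_rfl hnear hsel hN
    (Z := fun i n ω => (x i n ω, r i n ω)) hlaw hindep L le_rfl
  have hmax : max ε ((83 / 100) ^ L * convRadius K B (noiseConst η) (gammaOne ν S) Δ) = ε := by
    refine max_eq_left ?_
    have h1 : ((83 / 100 : ℝ)) ^ L ≤ ε := by
      -- Six contractions gain a factor e, so L of them bring the factor below ε; the initial radius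
      -- is less than 1.
      have h6 : (83 / 100 : ℝ) ^ 6 ≤ Real.exp (-1) := by
        rw [Real.exp_neg, ← one_div, le_div_iff₀ (Real.exp_pos 1)]
        nlinarith [Real.exp_one_lt_d9]
      rw [hL, pow_mul]
      calc ((83 / 100 : ℝ) ^ 6) ^ ⌈Real.log ε⁻¹⌉₊ ≤ Real.exp (-1) ^ ⌈Real.log ε⁻¹⌉₊ :=
            pow_le_pow_left₀ (by positivity) h6 _
        _ = Real.exp (-⌈Real.log ε⁻¹⌉₊) := by rw [← Real.exp_nat_mul]; ring_nf
        _ ≤ Real.exp (-Real.log ε⁻¹) := Real.exp_le_exp.2 (neg_le_neg (Nat.le_ceil _))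
        _ = ε := by rw [Real.log_inv, neg_neg, Real.exp_log hε0]
    calc _ ≤ ε * 1 := mul_le_mul h1 (by linarith) hRpos.le hε0.le
      _ = ε := mul_one ε
  rw [hmax] at hfinal
  refine (measure_mono fun ω hω => ?_).trans (hfinal.trans (le_of_eq ?_))
  · intro hmem
    exact hω (dist_le_of_mem_nearSet hε0.le hmem)
  -- The constant 18 is 3 per iteration times 6 iterations per unit of the rounded logarithm.
  · rw [← ENNReal.ofReal_natCast, ← ENNReal.ofReal_mul (by positivity), hL]
    congr 1
    push_cast
    ring
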